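/- Let $G=(A,B,E)$ be a finite bipartite graph (edges written $e=(v,u)$ with $v\in A$, $u\in B$) in which every edge $e$ is realized independently with probability $p_e\in[0,1]$. For a vertex $w$ let $E_w$ be the set of edges at $w$. Let $\mathbf x=(x_e)_{e\in E}$ be a feasible solution of the matching LP, i.e. $x_e\ge 0$ and $\sum_{e\in F}x_e\le 1-\prod_{e\in F}(1-p_e)$ for every vertex $w\in A\cup B$ and every $F\subseteq E_w$, and let $\sigma\in(0,1]$ satisfy $\sum_{e\in E_u}x_e\le\sigma$ for all $u\in B$. *Dummy edges.* For every $u\in B$ add a new vertex to $A$ whose only edge is a dummy edge to $u$, with realization probability $1$ and $x$-value $\sigma-\sum_{e\in E_u}x_e$ (sum over the original edges). From now on $A$, $E$, $\mathbf x$, $\mathbf p$ include the dummy vertices and edges. Put $\tilde x_e=g(x_e,\sigma)$, where $$g(x,\sigma)=\frac{(e^{\sigma}-1)(\sigma-x)x}{\sigma(e^{\sigma}-e^{x})}\quad(0\le x<\sigma),\qquad g(\sigma,\sigma)=1-e^{-\sigma}.$$ *Proportional distributions.* For each $v\in A$ let $\mathcal D_v$ be any distribution over permutations of subsets of $E_v$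 that is proportional to $\mathbf x$: if $\pi\sim\mathcal D_v$ and its edges are queried in order, each $e\in E_v$ is the first realized edge with probability exactly $x_e$. *DIST.* To draw a proposal list for $v$, draw $\pi\sim\mathcal D_v$ and go through the edges $e$ of $\pi$ in order, each time drawing a fresh $c$ uniformly from $[0,1]$. If $c\le p_e(1-\tilde x_e/x_e)$, stop; if $p_e(1-\tilde x_e/x_e)<c\le p_e(1-\tilde x_e/x_e)+\tilde x_e/x_e$, append $e$ to the proposal list; otherwise skip $e$. (When $x_e=0$, the ratio $\tilde x_e/x_e$ is read as $0$.) *Alg1.* Start with $\mathcal M=\emptyset$ and process the vertices $v\in A$ in a uniformly random order. For each $v$, draw a proposal list by DIST and examine its edges in order until one is realized. Examining $e$ means querying it if both its end-points are unmatched, and otherwise tossing an independent coin that shows "realized" with probability $p_e$. If $e=(v,u)$ is found realized, $v$ proposes to $u$, and $e$ joins $\mathcal M$ if $u$ is unmatched; in either case the processing of $v$ ends. Let $\mathcal M_1$ be the final $\mathcal M$. Then every edge $e$ (original or dummy) satisfies $$\frac{(1-e^{-\sigma})\,x_e}{\sigma}\;\le\;\Pr[e\in\mathcal M_1]\;\le\;\frac{x_e\,(1+e^{-\sigma})}{2}.$$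 -/

import Mathlib

namespace QueryCommit

noncomputable section

open MeasureTheory

/-! Bipartite graphs with finite sides `V` and `W`; an edge is a pair `(v, u)` and the edge set is
`E : Finset (V × W)`. Edge data (`p`, `x`) are functions on pairs; only the values on `E` matter. -/

section Graph

variable {V W : Type*} [DecidableEq V] [DecidableEq W]

/-- The edges of `E` at the left vertex `v`. -/
def edgesL (E : Finset (V × W)) (v : V) : Finset (V × W) := E.filter (fun e => e.1 = v)

/-- The edges of `E` at the right vertex `u`. -/
def edgesR (E : Finset (V × W)) (u : W) : Finset (V × W) := E.filter (fun e => e.2 = u)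

/-- `x` is a (feasible, not necessarily optimal) solution of the matching linear program:
`x ≥ 0`, and for every vertex and every set `F` of edges at that vertex, `∑_{e ∈ F} x_e` is at most
the probability `1 - ∏_{e ∈ F} (1 - p_e)` that some edge of `F` is realized. -/
structure IsLPSolution (E : Finset (V × W)) (p : V × W → unitInterval) (x : V × W → ℝ) : Prop where
  nonneg : ∀ e ∈ E, 0 ≤ x e
  left : ∀ v : V, ∀ F ⊆ edgesL E v, ∑ e ∈ F, x e ≤ 1 - ∏ e ∈ F, (1 - (p e : ℝ))
  right : ∀ u : W, ∀ F ⊆ edgesR E u, ∑ e ∈ F, x e ≤ 1 - ∏ e ∈ F, (1 - (p e : ℝ))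

theorem ofReal_add_ofReal_symm (q : unitInterval) :
    ENNReal.ofReal (q : ℝ) + ENNReal.ofReal (1 - (q : ℝ)) = 1 := by
  rw [← ENNReal.ofReal_add q.2.1 (sub_nonneg.2 q.2.2)]
  simp

/-- The random realized subgraph: every edge `e ∈ E` is present independently with
probability `p e`. -/
def realized (E : Finset (V × W)) (p : V × W → unitInterval) : PMF (Finset (V × W)) :=
  PMF.ofFinset
    (fun R => if R ∈ E.powerset then
        (∏ e ∈ R, ENNReal.ofReal (p e : ℝ)) * ∏ e ∈ E \ R, ENNReal.ofReal (1 - (p e : ℝ))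
      else 0)
    E.powerset
    (by
      rw [Finset.sum_congr rfl (fun R hR => if_pos hR), ← Finset.prod_add]
      exact Finset.prod_eq_one (fun e _ => ofReal_add_ofReal_symm (p e)))
    (fun R hR => if_neg hR)

/-- A coin that shows `true` with probability `q`. -/
def coin (q : unitInterval) : PMF Bool :=
  PMF.ofFintype
    (fun b => if b then ENNReal.ofReal (q : ℝ) else ENNReal.ofReal (1 - (q : ℝ)))
    (by simpa using ofReal_add_ofReal_symm q)

/-! ### Proportional distributions -/

/-- The law of the first realized edge (`none` if there is none) when the edges of a random list
drawn from `D` are queried in the order of the list. -/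
def firstRealized (E : Finset (V × W)) (p : V × W → unitInterval) (D : PMF (List (V × W))) :
    PMF (Option (V × W)) :=
  D.bind fun l => (realized E p).bind fun R => PMF.pure (l.find? fun e => decide (e ∈ R))

/-- `D` is a distribution over permutations of subsets of the edges at the left vertex `v` (that is,
over duplicate-free lists of such edges), and it is proportional to `x`: each edge `e` at `v` is the
first realized edge with probability exactly `x e`. -/
structure IsProportional (E : Finset (V × W)) (p : V × W → unitInterval) (x : V × W → ℝ) (v : V)
    (D : PMF (List (V × W))) : Prop where
  perm : ∀ l ∈ D.support, l.Nodup ∧ ∀ e ∈ l, e ∈ edgesL E v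
  prob : ∀ e ∈ edgesL E v, firstRealized E p D (some e) = ENNReal.ofReal (x e)

/-! ### The proposal distributions -/

/-- What the construction of the proposal list does with the current edge: end the loop, append the
edge to the list, or do neither. -/
inductive Verdict
  | halt
  | append
  | skip

instance : Finite Verdict :=
  Finite.of_injective
    (fun a : Verdict => match a with
      | .halt => (0 : Fin 3)
      | .append => 1
      | .skip => 2)
    (by intro a b; cases a <;> cases b <;> simp)

instance : MeasurableSpace Verdict := ⊤

instance : MeasurableSingletonClass Verdict := ⟨fun _ => trivial⟩

/-- The verdict for an edge with probability `q` and ratio `r = x̃ / x`, given the random number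
`c ∈ [0, 1]`. -/
def verdict (q r : ℝ) (c : unitInterval) : Verdict :=
  if (c : ℝ) ≤ q * (1 - r) then .halt
  else if (c : ℝ) ≤ q * (1 - r) + r then .append
  else .skip

theorem measurable_verdict (q r : ℝ) : Measurable (verdict q r) := by
  unfold verdict
  refine Measurable.ite ?_ measurable_const (Measurable.ite ?_ measurable_const measurable_const)
  · exact measurableSet_le measurable_subtype_coe measurable_const
  · exact measurableSet_le measurable_subtype_coe measurable_const

instance (q r : ℝ) : IsProbabilityMeasure ((volume : Measure unitInterval).map (verdict q r)) :=
  Measure.isProbabilityMeasure_map (measurable_verdict q r).aemeasurable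

/-- The law of the verdict when `c` is uniform on `[0, 1]`. -/
def randomVerdict (q r : ℝ) : PMF Verdict := ((volume : Measure unitInterval).map (verdict q r)).toPMF

/-- Thin out a list of edges, going through it in order; `xt` is the modified solution. -/
def thin (p : V × W → unitInterval) (x xt : V × W → ℝ) : List (V × W) → PMF (List (V × W))
  | [] => PMF.pure []
  | e :: l => (randomVerdict (p e) (xt e / x e)).bind fun a =>
      match a with
      | .halt => PMF.pure []
      | .append => (thin p x xt l).map (fun l' => e :: l')
      | .skip => thin p x xt l

/-- The proposal distribution built from a proportional distribution `D`: draw a list from `D` and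
thin it out. -/
def proposalDist (p : V × W → unitInterval) (x xt : V × W → ℝ) (D : PMF (List (V × W))) : PMF (List (V × W)) :=
  D.bind (thin p x xt)

/-! ### The matching process, given the realized subgraph `R` -/

/-- The left vertex `v` is unmatched in `M`. -/
def FreeL (M : Finset (V × W)) (v : V) : Prop := ∀ f ∈ M, f.1 ≠ v

/-- The right vertex `u` is unmatched in `M`. -/
def FreeR (M : Finset (V × W)) (u : W) : Prop := ∀ f ∈ M, f.2 ≠ u

instance (M : Finset (V × W)) (v : V) : Decidable (FreeL M v) := by
  unfold FreeL; infer_instance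

instance (M : Finset (V × W)) (u : W) : Decidable (FreeR M u) := by
  unfold FreeR; infer_instance

/-- Examine `e` when the current matching is `M`: if both end-points are unmatched, `e` is queried,
otherwise a coin with success probability `p e` is tossed. The result `true` means "realized". -/
def examine (p : V × W → unitInterval) (R M : Finset (V × W)) (e : V × W) : PMF Bool :=
  if FreeL M e.1 ∧ FreeR M e.2 then PMF.pure (decide (e ∈ R)) else coin (p e)

/-- Examine the edges of a list in order until one is realized. That edge `(v, u)` is proposed
to `u`; it joins the matching if `u` is unmatched, and in either case the loop terminates. The result
is the new matching. -/
def propose (p : V × W → unitInterval) (R M : Finset (V × W)) : List (V × W) → PMF (Finset (V × W))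
  | [] => PMF.pure M
  | e :: l => (examine p R M e).bind fun b =>
      if b then PMF.pure (if FreeR M e.2 then insert e M else M)
      else propose p R M l

/-- Process the left vertices of a list in order, starting from the matching `M`; the proposal list
of `v` is drawn from `Q v`. -/
def process (p : V × W → unitInterval) (Q : V → PMF (List (V × W))) (R : Finset (V × W)) :
    List V → Finset (V × W) → PMF (Finset (V × W))
  | [], M => PMF.pure M
  | v :: vs, M => (Q v).bind fun l => (propose p R M l).bind fun M' => process p Q R vs M'

/-- A uniformly random order on the finite set `V`, as a list of all its elements. -/
def uniformOrder (V : Type*) [Fintype V] [DecidableEq V] : PMF (List V) :=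
  haveI : Nonempty (Fin (Fintype.card V) ≃ V) := ⟨(Fintype.equivFin V).symm⟩
  (PMF.uniformOfFintype (Fin (Fintype.card V) ≃ V)).map (fun π : Fin (Fintype.card V) ≃ V => List.ofFn fun i => π i)

/-- The matching process on the random realized subgraph of `(V, W, E)` with a uniformly random
order on `V`. -/
def randomMatching [Fintype V] (E : Finset (V × W)) (p : V × W → unitInterval)
    (Q : V → PMF (List (V × W))) : PMF (Finset (V × W)) :=
  (realized E p).bind fun R => (uniformOrder V).bind fun vs => process p Q R vs ∅

end Graph

/-! ### Dummy edges and the algorithm -/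

section Algorithm

variable {A B : Type*} [DecidableEq A] [DecidableEq B]

/-- The edge set after adding dummy edges: each `u : B` gets a new left neighbour `Sum.inr u`, which
has no other edge. -/
def dummyE [Fintype B] (E : Finset (A × B)) : Finset ((A ⊕ B) × B) :=
  E.image (fun e => (Sum.inl e.1, e.2)) ∪ Finset.univ.image (fun u : B => (Sum.inr u, u))

/-- Dummy edges have realization probability `1`. -/
def dummyP (p : A × B → unitInterval) : (A ⊕ B) × B → unitInterval
  | (Sum.inl v, u) => p (v, u)
  | (Sum.inr _, _) => 1

/-- The dummy edge at `u` has value `σ - ∑_{e ∋ u} x_e`. -/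
def dummyX (E : Finset (A × B)) (x : A × B → ℝ) (σ : ℝ) : (A ⊕ B) × B → ℝ
  | (Sum.inl v, u) => x (v, u)
  | (Sum.inr _, u) => σ - ∑ e ∈ edgesR E u, x e

/-- The transformation function on `0 ≤ x ≤ σ`. -/
def g (x σ : ℝ) : ℝ :=
  if x = σ then 1 - Real.exp (-σ)
  else (Real.exp σ - 1) * (σ - x) * x / (σ * (Real.exp σ - Real.exp x))

/-- The matching (in the graph with dummy edges) returned by the algorithm. `D` is the choice of
proportional distributions from which the proposal distributions are built. -/
def alg1 [Fintype A] [Fintype B] (E : Finset (A × B)) (p : A × B → unitInterval) (x : A × B → ℝ) (σ : ℝ)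
    (D : A ⊕ B → PMF (List ((A ⊕ B) × B))) : PMF (Finset ((A ⊕ B) × B)) :=
  randomMatching (dummyE E) (dummyP p)
    (fun v => proposalDist (dummyP p) (dummyX E x σ) (fun e => g (dummyX E x σ e) σ) (D v))

/-- The probability that `e` belongs to a random edge set with law `P`. -/
def probMem {V W : Type*} (P : PMF (Finset (V × W))) (e : V × W) : ℝ :=
  (P.toOuterMeasure {M | e ∈ M}).toReal

end Algorithm

end

end QueryCommit

namespace QueryCommit

open MeasureTheory

/-! ### The transformation function -/

/-! Tossing a coin for a blocked edge makes every examination a fresh coin, so the proposal of a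
vertex is independent of the current matching and of all other proposals. DIST is designed so that
`v` proposes along `e` with probability exactly `g (x e) σ`. A vertex `u` accepts the first proposal
it gets. Hence, in a uniformly random order, `e = (v, u)` is matched with probability `g (x e) σ * ∫
t in 0..1, ∏ (1 - t * g (x f) σ)`, the product running over the other edges `f` at `u`
(`probMem_randomMatching`). The dummy edges make the values at `u` sum to exactly `σ`.

What remains is analysis. With `F s = (1 - exp (-s)) / s = ∫ exp (-t s)` over `[0, 1]` and `F 0 =
1`, the definition of `g` reads `g x σ = x * F σ / F (σ - x)`. For the lower bound, each factor may
be replaced by `exp (-t * y)` under the integral; the resulting integral is `F (σ - x)`, and the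
product with `g x σ` is the claimed value exactly. For the upper bound, all factors may be merged
into the single factor `1 - t * g (σ - x) σ`, after which `g_mul_le` finishes.

Neither replacement holds pointwise. In each, the pointwise error is at worst a nonnegative multiple
of `t * (2/3 - t)`, which has integral zero and changes sign once, so it integrates to something
nonnegative against any antitone weight (`integral_weight_le`). The other factors serve as that
weight. -/

/-- The ratio `g x σ / x`, extended continuously to `x = 0`. -/
noncomputable def gRatio (x σ : ℝ) : ℝ :=
  if x = σ then (1 - Real.exp (-σ)) / σ
  else (Real.exp σ - 1) * (σ - x) / (σ * (Real.exp σ - Real.exp x))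

theorem g_eq_mul_gRatio {σ : ℝ} (hσ : 0 < σ) (x : ℝ) : g x σ = x * gRatio x σ := by
  unfold g gRatio
  split_ifs with h
  · rw [h]; field_simp
  · ring

theorem g_zero {σ : ℝ} (hσ : 0 < σ) : g 0 σ = 0 := by
  rw [g_eq_mul_gRatio hσ, zero_mul]

/-- This is `F x ≤ 2 / (2 + x)`: the difference of the two sides vanishes at `0` and has derivative
`(1 - (1 + y) * exp (-y)) / 2 ≥ 0`. -/
theorem one_sub_exp_neg_mul_le {x : ℝ} (hx : 0 ≤ x) :
    (1 - Real.exp (-x)) * (1 + x / 2) ≤ x := by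
  have hmono : MonotoneOn (fun y : ℝ => y - (1 - Real.exp (-y)) * (1 + y / 2)) (Set.Ici 0) := by
    have hd : ∀ y : ℝ, HasDerivAt (fun y : ℝ => y - (1 - Real.exp (-y)) * (1 + y / 2))
        (1 - (Real.exp (-y) * (1 + y / 2) + (1 - Real.exp (-y)) * (1 / 2))) y := by
      intro y
      have h1 : HasDerivAt (fun y : ℝ => 1 - Real.exp (-y)) (Real.exp (-y)) y := by
        have := ((hasDerivAt_neg y).exp).const_sub 1
        simpa using this
      have h2 : HasDerivAt (fun y : ℝ => 1 + y / 2) (1 / 2) y :=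
        ((hasDerivAt_id y).div_const 2).const_add 1
      exact (hasDerivAt_id y).sub (h1.mul h2)
    refine monotoneOn_of_hasDerivWithinAt_nonneg (convex_Ici 0)
      (fun y _ => (hd y).continuousAt.continuousWithinAt)
      (fun y _ => (hd y).hasDerivWithinAt) ?_
    intro y hy
    have h1 : (1 + y) * Real.exp (-y) ≤ 1 := by
      rw [Real.exp_neg, ← div_eq_mul_inv, div_le_one (Real.exp_pos y), add_comm]
      exact Real.add_one_le_exp y
    nlinarith
  have := hmono (Set.mem_Ici.2 le_rfl) (Set.mem_Ici.2 hx) hx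
  simp only [neg_zero, Real.exp_zero] at this
  linarith

/-- This is `gRatio_le` with denominators cleared. The function `(2 + σ - y) * exp y` has second
derivative `(σ - y) * exp y`, so it is convex on `[0, σ]` and lies below its chord, whose end values
are `2 + σ` and `2 * exp σ`. -/
theorem chord_bound {σ y : ℝ} (hσ : 0 < σ) (hy : 0 ≤ y) (hyσ : y ≤ σ) :
    σ * ((2 + σ - y) * Real.exp y) ≤ (σ - y) * (2 + σ) + y * (2 * Real.exp σ) := by
  have hc : ConvexOn ℝ (Set.Icc 0 σ) (fun y : ℝ => (2 + σ - y) * Real.exp y) := by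
    have h1 : ∀ y : ℝ, HasDerivAt (fun y : ℝ => (2 + σ - y) * Real.exp y)
        ((1 + σ - y) * Real.exp y) y := by
      intro y
      have := ((hasDerivAt_id y).const_sub (2 + σ)).mul (Real.hasDerivAt_exp y)
      refine this.congr_deriv ?_
      simp only [id]; ring
    have h2 : ∀ y : ℝ, HasDerivAt (fun y : ℝ => (1 + σ - y) * Real.exp y)
        ((σ - y) * Real.exp y) y := by
      intro y
      have := ((hasDerivAt_id y).const_sub (1 + σ)).mul (Real.hasDerivAt_exp y)
      refine this.congr_deriv ?_
      simp only [id]; ring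
    refine convexOn_of_hasDerivWithinAt2_nonneg (convex_Icc 0 σ)
      (fun y _ => (h1 y).continuousAt.continuousWithinAt)
      (fun y _ => (h1 y).hasDerivWithinAt) (fun y _ => (h2 y).hasDerivWithinAt) ?_
    intro y hy
    rw [interior_Icc] at hy
    exact mul_nonneg (by linarith [hy.2]) (Real.exp_pos y).le
  have := hc.2 (Set.left_mem_Icc.2 hσ.le) (Set.right_mem_Icc.2 hσ.le)
    (show 0 ≤ 1 - y / σ by rw [sub_nonneg, div_le_one hσ]; exact hyσ)
    (show 0 ≤ y / σ by positivity) (by ring)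
  have e1 : (1 - y / σ) • (0 : ℝ) + (y / σ) • σ = y := by
    simp only [smul_eq_mul]; field_simp; ring
  simp only [e1] at this
  have h3 := mul_le_mul_of_nonneg_left this hσ.le
  refine h3.trans (le_of_eq ?_)
  simp only [smul_eq_mul, Real.exp_zero]
  field_simp
  ring

theorem gRatio_nonneg {σ x : ℝ} (hσ : 0 < σ) (hxσ : x ≤ σ) : 0 ≤ gRatio x σ := by
  unfold gRatio
  split_ifs with h
  · exact div_nonneg (sub_nonneg.2 (Real.exp_le_one_iff.2 (by linarith))) hσ.le
  · have h1 : 1 ≤ Real.exp σ := Real.one_le_exp hσ.le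
    have h2 : Real.exp x ≤ Real.exp σ := Real.exp_le_exp.2 hxσ
    exact div_nonneg (mul_nonneg (by linarith) (by linarith)) (mul_nonneg hσ.le (by linarith))

theorem gRatio_le {σ x : ℝ} (hσ : 0 < σ) (hx : 0 ≤ x) (hxσ : x ≤ σ) :
    gRatio x σ ≤ 1 - x / (2 + σ) := by
  unfold gRatio
  split_ifs with h
  · subst h
    have := one_sub_exp_neg_mul_le hx
    have e : 1 - x / (2 + x) = 2 / (2 + x) := by field_simp; ring
    rw [e, div_le_div_iff₀ hσ (by linarith)]
    linarith
  · have hlt : x < σ := lt_of_le_of_ne hxσ h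
    have h2 : Real.exp x < Real.exp σ := Real.exp_lt_exp.2 hlt
    have e : 1 - x / (2 + σ) = (2 + σ - x) / (2 + σ) := by field_simp
    rw [e, div_le_div_iff₀ (mul_pos hσ (by linarith)) (by linarith)]
    linarith [chord_bound hσ hx hxσ]

theorem gRatio_le_third {σ x : ℝ} (hσ : 0 < σ) (hσ1 : σ ≤ 1) (hx : 0 ≤ x) (hxσ : x ≤ σ) :
    gRatio x σ ≤ 1 - x / 3 := by
  refine (gRatio_le hσ hx hxσ).trans ?_
  have : x / 3 ≤ x / (2 + σ) := div_le_div_of_nonneg_left hx (by linarith) (by linarith)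
  linarith

theorem gRatio_le_one {σ x : ℝ} (hσ : 0 < σ) (hx : 0 ≤ x) (hxσ : x ≤ σ) : gRatio x σ ≤ 1 := by
  refine (gRatio_le hσ hx hxσ).trans ?_
  have : 0 ≤ x / (2 + σ) := by positivity
  linarith

/-- Since `gRatio x σ = F σ / F (σ - x)`, the product telescopes. -/
theorem gRatio_add {σ a b : ℝ} (ha : 0 ≤ a) (hab : a + b ≤ σ) (haσ : a < σ) :
    gRatio (a + b) σ = gRatio a σ * gRatio b (σ - a) := by
  have h1 : Real.exp σ - Real.exp a ≠ 0 := (sub_pos.2 (Real.exp_lt_exp.2 haσ)).ne'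
  have hσ : σ ≠ 0 := by linarith
  have hs : σ - a ≠ 0 := by linarith
  unfold gRatio
  by_cases h : a + b = σ
  · have hb' : b = σ - a := by linarith
    rw [if_pos h, if_neg haσ.ne, if_pos hb']
    rw [neg_sub, Real.exp_sub, Real.exp_neg]
    have := (Real.exp_pos σ).ne'
    field_simp
  · have hb' : ¬ b = σ - a := fun hh => h (by linarith)
    have hlt : a + b < σ := lt_of_le_of_ne hab h
    rw [if_neg h, if_neg haσ.ne, if_neg hb']
    have h2 : Real.exp σ - Real.exp a * Real.exp b ≠ 0 := by
      rw [← Real.exp_add]; exact (sub_pos.2 (Real.exp_lt_exp.2 hlt)).ne'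
    rw [Real.exp_sub, Real.exp_add]
    have h4 := (Real.exp_pos a).ne'
    have h5 : Real.exp σ / Real.exp a - Real.exp b
        = (Real.exp σ - Real.exp a * Real.exp b) / Real.exp a := by field_simp
    rw [h5]
    field_simp
    ring

theorem gRatio_add_le {σ a b : ℝ} (hσ : 0 < σ) (hσ1 : σ ≤ 1) (ha : 0 ≤ a) (hb : 0 ≤ b)
    (hab : a + b ≤ σ) : gRatio (a + b) σ ≤ gRatio a σ * (1 - b / 3) := by
  rcases (le_trans (le_add_of_nonneg_right hb) hab).lt_or_eq with h | h
  · rw [gRatio_add ha hab h]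
    exact mul_le_mul_of_nonneg_left
      (gRatio_le_third (by linarith) (by linarith) hb (by linarith)) (gRatio_nonneg hσ h.le)
  · have : b = 0 := by linarith
    simp [this]

theorem g_nonneg {σ x : ℝ} (hσ : 0 < σ) (hx : 0 ≤ x) (hxσ : x ≤ σ) : 0 ≤ g x σ := by
  rw [g_eq_mul_gRatio hσ]; exact mul_nonneg hx (gRatio_nonneg hσ hxσ)

theorem g_le_self {σ x : ℝ} (hσ : 0 < σ) (hx : 0 ≤ x) (hxσ : x ≤ σ) : g x σ ≤ x := by
  rw [g_eq_mul_gRatio hσ]; exact mul_le_of_le_one_right hx (gRatio_le_one hσ hx hxσ)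

theorem g_le_sub_sq {σ x : ℝ} (hσ : 0 < σ) (hσ1 : σ ≤ 1) (hx : 0 ≤ x) (hxσ : x ≤ σ) :
    g x σ ≤ x - x ^ 2 / 3 := by
  rw [g_eq_mul_gRatio hσ]
  have := mul_le_mul_of_nonneg_left (gRatio_le_third hσ hσ1 hx hxσ) hx
  linarith

/-- Split `(a + b) * gRatio (a + b) σ` into its `a` and `b` parts and bound them by `gRatio_add_le`
in the two orders. The saving `a * b * (gRatio a σ + gRatio b σ) / 3` is at least the product term
because both ratios are at most `1`. -/
theorem g_add_le {σ a b : ℝ} (hσ : 0 < σ) (hσ1 : σ ≤ 1) (ha : 0 ≤ a) (hb : 0 ≤ b)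
    (hab : a + b ≤ σ) : g (a + b) σ ≤ g a σ + g b σ - 2 / 3 * (g a σ * g b σ) := by
  have h1 := gRatio_add_le hσ hσ1 ha hb hab
  have h2 := gRatio_add_le hσ hσ1 hb ha (by linarith)
  rw [add_comm b a] at h2
  simp only [g_eq_mul_gRatio hσ]
  have ka := gRatio_nonneg hσ (x := a) (by linarith)
  have kb := gRatio_nonneg hσ (x := b) (by linarith)
  have ka1 := gRatio_le_one hσ ha (by linarith)
  have kb1 := gRatio_le_one hσ hb (by linarith)
  have h3 : a * b * (gRatio a σ * gRatio b σ) ≤ a * b * gRatio a σ :=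
    mul_le_mul_of_nonneg_left (mul_le_of_le_one_right ka kb1) (mul_nonneg ha hb)
  have h4 : a * b * (gRatio a σ * gRatio b σ) ≤ a * b * gRatio b σ :=
    mul_le_mul_of_nonneg_left (mul_le_of_le_one_left kb ka1) (mul_nonneg ha hb)
  have h5 := mul_le_mul_of_nonneg_left h1 ha
  have h6 := mul_le_mul_of_nonneg_left h2 hb
  linarith

/-- Here `g (σ - x) σ` equals `(1 - exp (-σ)) * (1 - x / σ) / F x`, and `1 / F x ≥ 1 + x / 2`. -/
theorem g_sub_ge {σ x : ℝ} (hσ : 0 < σ) (hx : 0 < x) (hxσ : x ≤ σ) :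
    (1 - Real.exp (-σ)) * (1 - x / σ) * (1 + x / 2) ≤ g (σ - x) σ := by
  have h1 : 0 < 1 - Real.exp (-x) := sub_pos.2 (Real.exp_lt_one_iff.2 (by linarith))
  have h2 : 1 + x / 2 ≤ x / (1 - Real.exp (-x)) := by
    rw [le_div_iff₀ h1]; linarith [one_sub_exp_neg_mul_le hx.le]
  have e : g (σ - x) σ = (1 - Real.exp (-σ)) * (1 - x / σ) * (x / (1 - Real.exp (-x))) := by
    unfold g
    rw [if_neg (by linarith), sub_sub_cancel]
    have e1 : Real.exp σ - Real.exp (σ - x) = Real.exp σ * (1 - Real.exp (-x)) := by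
      rw [mul_sub, mul_one, ← Real.exp_add, sub_eq_add_neg σ x]
    have e2 : Real.exp σ - 1 = Real.exp σ * (1 - Real.exp (-σ)) := by
      rw [mul_sub, mul_one, ← Real.exp_add, add_neg_cancel, Real.exp_zero]
    have h3 := (Real.exp_pos σ).ne'
    rw [e1, e2]
    have h4 := h1.ne'
    field_simp
  rw [e]
  refine mul_le_mul_of_nonneg_left h2 (mul_nonneg ?_ ?_)
  · exact sub_nonneg.2 (Real.exp_le_one_iff.2 (by linarith))
  · rw [sub_nonneg, div_le_one hσ]; exact hxσ

theorem g_mul_le {σ x : ℝ} (hσ : 0 < σ) (hσ1 : σ ≤ 1) (hx : 0 ≤ x) (hxσ : x ≤ σ) :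
    g x σ * (1 - g (σ - x) σ / 2) ≤ x * (1 + Real.exp (-σ)) / 2 := by
  rcases hx.eq_or_lt with rfl | hx0
  · simp [g_zero hσ]
  set q := 1 - Real.exp (-σ) with hq
  have hq2 : q * (2 + σ) ≤ 2 * σ := by linarith [one_sub_exp_neg_mul_le hσ.le]
  have hq0 : 0 ≤ q := sub_nonneg.2 (Real.exp_le_one_iff.2 (by linarith))
  have h1 := g_sub_ge hσ hx0 hxσ
  have h2 : g (σ - x) σ ≤ 1 := (g_le_self hσ (by linarith) (by linarith)).trans (by linarith)
  have h3 : g x σ ≤ x * (1 - x / (2 + σ)) := by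
    rw [g_eq_mul_gRatio hσ]; exact mul_le_mul_of_nonneg_left (gRatio_le hσ hx hxσ) hx
  have h4 : x / (2 + σ) ≤ 1 := by rw [div_le_one (by linarith)]; linarith
  have h5 : (1 - x / (2 + σ)) * (1 - q * (1 - x / σ) * (1 + x / 2) / 2) ≤ 1 - q / 2 := by
    set r := x / (2 + σ) with hr
    set s := x / σ with hs
    have hx1 : x = r * (2 + σ) := by rw [hr]; field_simp
    have hx2 : x = s * σ := by rw [hs]; field_simp
    have hs1 : s ≤ 1 := by rw [hs, div_le_one hσ]; exact hxσ
    have hs0 : 0 ≤ s := by positivity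
    have hr0 : 0 ≤ r := by positivity
    -- Both losses are governed by `r`: `a1` removes the factor `1 - r` from the subtracted product,
    -- and the leftover `q * s / 2` is paid for by the term `-r` through `a4`.
    have a1 : 1 ≤ (1 - r) * (1 + x / 2) := by
      have : (1 - r) * (1 + x / 2) - 1 = r * (σ - x) / 2 := by
        rw [show x / 2 = r * (2 + σ) / 2 by rw [← hx1], show σ - x = σ - r * (2 + σ) by rw [← hx1]]
        ring
      nlinarith [mul_nonneg hr0 (sub_nonneg.2 hxσ)]
    have a2 : 1 - s ≤ (1 - r) * (1 - s) * (1 + x / 2) := by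
      nlinarith [mul_le_mul_of_nonneg_left a1 (sub_nonneg.2 hs1)]
    have a3 : q * (1 - s) ≤ q * ((1 - r) * (1 - s) * (1 + x / 2)) :=
      mul_le_mul_of_nonneg_left a2 hq0
    have a4 : q * s ≤ 2 * r := by
      have : q * s = q * (2 + σ) * (r / σ) := by rw [hs, hr]; field_simp
      rw [this]
      calc q * (2 + σ) * (r / σ) ≤ 2 * σ * (r / σ) :=
            mul_le_mul_of_nonneg_right hq2 (by positivity)
        _ = 2 * r := by field_simp
    nlinarith
  calc g x σ * (1 - g (σ - x) σ / 2) ≤ x * (1 - x / (2 + σ)) * (1 - g (σ - x) σ / 2) :=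
        mul_le_mul_of_nonneg_right h3 (by linarith)
    _ ≤ x * (1 - x / (2 + σ)) * (1 - q * (1 - x / σ) * (1 + x / 2) / 2) :=
        mul_le_mul_of_nonneg_left (by linarith) (mul_nonneg hx (by linarith))
    _ = x * ((1 - x / (2 + σ)) * (1 - q * (1 - x / σ) * (1 + x / 2) / 2)) := by ring
    _ ≤ x * (1 - q / 2) := mul_le_mul_of_nonneg_left h5 hx
    _ = x * (1 + Real.exp (-σ)) / 2 := by rw [hq]; ring

/-! ### Integrals of products -/

theorem integral_two_thirds_nonneg {φ : ℝ → ℝ} (hc : Continuous φ)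
    (ha : AntitoneOn φ (Set.Icc 0 1)) : 0 ≤ ∫ t in (0 : ℝ)..1, t * (2 / 3 - t) * φ t := by
  -- The constant `2/3` is the one for which `t * (2/3 - t)` has integral zero. Replacing `φ t` by
  -- `φ (2/3)` only decreases the integrand, on either side of `2/3`.
  have h : ∫ t in (0 : ℝ)..1, t * (2 / 3 - t) * φ (2 / 3) = 0 := by
    have e : ∀ t : ℝ, t * (2 / 3 - t) * φ (2 / 3) = (2 / 3 * t - t ^ 2) * φ (2 / 3) := by
      intro t; ring
    simp only [e]
    rw [intervalIntegral.integral_mul_const, intervalIntegral.integral_sub,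
      intervalIntegral.integral_const_mul, integral_id, integral_pow]
    · norm_num
    · exact Continuous.intervalIntegrable (by fun_prop) _ _
    · exact Continuous.intervalIntegrable (by fun_prop) _ _
  refine h.symm.trans_le ?_
  refine intervalIntegral.integral_mono_on zero_le_one ?_ ?_ ?_
  · exact Continuous.intervalIntegrable (by fun_prop) _ _
  · exact Continuous.intervalIntegrable (by fun_prop) _ _
  intro t ht
  have hm : (2 / 3 : ℝ) ∈ Set.Icc (0 : ℝ) 1 := by constructor <;> norm_num
  rcases le_total t (2 / 3) with h1 | h1
  · exact mul_le_mul_of_nonneg_left (ha ht hm h1) (mul_nonneg ht.1 (by linarith))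
  · exact mul_le_mul_of_nonpos_left (ha hm ht h1) (mul_nonpos_of_nonneg_of_nonpos ht.1 (by linarith))

/-- If `f ≥ h + c t (2/3 - t)` on `[0, 1]` with `c ≥ 0`, then `∫ φ h ≤ ∫ φ f` for every nonnegative
antitone weight `φ`. -/
theorem integral_weight_le {φ f h : ℝ → ℝ} {c : ℝ} (hφ : Continuous φ) (hf : Continuous f)
    (hh : Continuous h) (ha : AntitoneOn φ (Set.Icc 0 1)) (h0 : ∀ t ∈ Set.Icc (0 : ℝ) 1, 0 ≤ φ t)
    (hc : 0 ≤ c) (hle : ∀ t ∈ Set.Icc (0 : ℝ) 1, h t + c * (t * (2 / 3 - t)) ≤ f t) :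
    ∫ t in (0 : ℝ)..1, φ t * h t ≤ ∫ t in (0 : ℝ)..1, φ t * f t := by
  have h1 : ∫ t in (0 : ℝ)..1, (φ t * h t + c * (t * (2 / 3 - t) * φ t))
      ≤ ∫ t in (0 : ℝ)..1, φ t * f t := by
    refine intervalIntegral.integral_mono_on zero_le_one
      (Continuous.intervalIntegrable (by fun_prop) _ _)
      (Continuous.intervalIntegrable (by fun_prop) _ _) ?_
    intro t ht
    have := mul_le_mul_of_nonneg_left (hle t ht) (h0 t ht)
    linarith
  rw [intervalIntegral.integral_add (Continuous.intervalIntegrable (by fun_prop) _ _)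
      (Continuous.intervalIntegrable (by fun_prop) _ _),
    intervalIntegral.integral_const_mul] at h1
  have := mul_nonneg hc (integral_two_thirds_nonneg hφ ha)
  linarith

theorem antitoneOn_mul_nonneg {φ f : ℝ → ℝ} {s : Set ℝ} (hφ : AntitoneOn φ s) (hf : AntitoneOn f s)
    (hφ0 : ∀ t ∈ s, 0 ≤ φ t) (hf0 : ∀ t ∈ s, 0 ≤ f t) : AntitoneOn (fun t => φ t * f t) s := by
  intro a ha b hb hab
  exact mul_le_mul (hφ ha hb hab) (hf ha hb hab) (hf0 b hb) (hφ0 a ha)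

theorem exp_neg_le_quadratic {z : ℝ} (hz : 0 ≤ z) : Real.exp (-z) ≤ 1 - z + z ^ 2 / 2 := by
  have h := Real.quadratic_le_exp_of_nonneg hz
  have h1 : 0 < 1 + z + z ^ 2 / 2 := by positivity
  rw [Real.exp_neg]
  calc (Real.exp z)⁻¹ ≤ (1 + z + z ^ 2 / 2)⁻¹ := inv_anti₀ h1 h
    _ ≤ 1 - z + z ^ 2 / 2 := by
      rw [inv_le_iff_one_le_mul₀ h1]
      nlinarith [pow_nonneg hz 4]

/-! ### Replacing and merging the factors of the product -/

section Products

variable {ι : Type*} {σ : ℝ}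

theorem antitoneOn_one_sub_mul {c : ℝ} (hc : 0 ≤ c) (s : Set ℝ) :
    AntitoneOn (fun t : ℝ => 1 - t * c) s := by
  intro a _ b _ hab
  have := mul_le_mul_of_nonneg_right hab hc
  simp only
  linarith

theorem one_sub_mul_nonneg {c t : ℝ} (hc : 0 ≤ c) (hc1 : c ≤ 1) (ht : t ∈ Set.Icc (0 : ℝ) 1) :
    0 ≤ 1 - t * c := by
  nlinarith [ht.1, ht.2]

/-- The arbitrary antitone weight is what makes the induction work: while one factor is exchanged,
the others are absorbed into the weight. -/
theorem integral_exp_le_integral_prod [DecidableEq ι] (hσ : 0 < σ) (hσ1 : σ ≤ 1) (y : ι → ℝ)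
    (s : Finset ι) (hy : ∀ i ∈ s, 0 ≤ y i ∧ y i ≤ σ) :
    ∀ φ : ℝ → ℝ, Continuous φ → AntitoneOn φ (Set.Icc 0 1) →
      (∀ t ∈ Set.Icc (0 : ℝ) 1, 0 ≤ φ t) →
      ∫ t in (0 : ℝ)..1, φ t * Real.exp (-(t * ∑ i ∈ s, y i))
        ≤ ∫ t in (0 : ℝ)..1, φ t * ∏ i ∈ s, (1 - t * g (y i) σ) := by
  induction s using Finset.induction_on with
  | empty => intro φ _ _ _; simp
  | insert a s has ih =>
    intro φ hφ hφa hφ0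
    obtain ⟨ya, yaσ⟩ := hy a (Finset.mem_insert_self a s)
    have ih' := ih (fun i hi => hy i (Finset.mem_insert_of_mem hi))
    have g0 := g_nonneg hσ ya yaσ
    have g1 : g (y a) σ ≤ 1 := (g_le_self hσ ya yaσ).trans (by linarith)
    have hY : 0 ≤ ∑ i ∈ s, y i :=
      Finset.sum_nonneg fun i hi => (hy i (Finset.mem_insert_of_mem hi)).1
    have st1 := ih' (fun t => φ t * (1 - t * g (y a) σ)) (by fun_prop)
      (antitoneOn_mul_nonneg hφa (antitoneOn_one_sub_mul g0 _) hφ0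
        (fun t ht => one_sub_mul_nonneg g0 g1 ht))
      (fun t ht => mul_nonneg (hφ0 t ht) (one_sub_mul_nonneg g0 g1 ht))
    have hea : AntitoneOn (fun t : ℝ => Real.exp (-(t * ∑ i ∈ s, y i))) (Set.Icc 0 1) := by
      intro b _ c _ hbc
      exact Real.exp_le_exp.2 (neg_le_neg (mul_le_mul_of_nonneg_right hbc hY))
    have st2 := integral_weight_le (φ := fun t => φ t * Real.exp (-(t * ∑ i ∈ s, y i)))
      (f := fun t => 1 - t * g (y a) σ) (h := fun t => Real.exp (-(t * y a))) (c := y a ^ 2 / 2)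
      (by fun_prop) (by fun_prop) (by fun_prop)
      (antitoneOn_mul_nonneg hφa hea hφ0 (fun t _ => (Real.exp_pos _).le))
      (fun t ht => mul_nonneg (hφ0 t ht) (Real.exp_pos _).le) (by positivity)
      -- From `g y σ ≤ y - y ^ 2 / 3` and `exp (-(t * y)) ≤ 1 - t * y + (t * y) ^ 2 / 2`, the
      -- difference is at least `y ^ 2 / 2 * (t * (2/3 - t))`.
      (by
        intro t ht
        have e := exp_neg_le_quadratic (mul_nonneg ht.1 ya)
        have := mul_le_mul_of_nonneg_left (g_le_sub_sq hσ hσ1 ya yaσ) ht.1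
        nlinarith)
    calc _ = ∫ t in (0 : ℝ)..1, φ t * Real.exp (-(t * ∑ i ∈ s, y i)) * Real.exp (-(t * y a)) := by
          refine intervalIntegral.integral_congr fun t _ => ?_
          rw [mul_assoc, ← Real.exp_add, Finset.sum_insert has]
          congr 2; ring
      _ ≤ _ := st2
      _ = ∫ t in (0 : ℝ)..1, φ t * (1 - t * g (y a) σ) * Real.exp (-(t * ∑ i ∈ s, y i)) :=
          intervalIntegral.integral_congr fun t _ => by ring
      _ ≤ _ := st1
      _ = _ := by
          refine intervalIntegral.integral_congr fun t _ => ?_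
          rw [Finset.prod_insert has, mul_assoc]

theorem integral_prod_le [DecidableEq ι] (hσ : 0 < σ) (hσ1 : σ ≤ 1) (y : ι → ℝ)
    (s : Finset ι) (hy : ∀ i ∈ s, 0 ≤ y i) (hs : ∑ i ∈ s, y i ≤ σ) :
    ∀ φ : ℝ → ℝ, Continuous φ → AntitoneOn φ (Set.Icc 0 1) →
      (∀ t ∈ Set.Icc (0 : ℝ) 1, 0 ≤ φ t) →
      ∫ t in (0 : ℝ)..1, φ t * ∏ i ∈ s, (1 - t * g (y i) σ)
        ≤ ∫ t in (0 : ℝ)..1, φ t * (1 - t * g (∑ i ∈ s, y i) σ) := by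
  induction s using Finset.induction_on with
  | empty => intro φ _ _ _; simp [g_zero hσ]
  | insert a s has ih =>
    intro φ hφ hφa hφ0
    rw [Finset.sum_insert has] at hs ⊢
    have ya := hy a (Finset.mem_insert_self a s)
    have hY : 0 ≤ ∑ i ∈ s, y i :=
      Finset.sum_nonneg fun i hi => hy i (Finset.mem_insert_of_mem hi)
    have yaσ : y a ≤ σ := by linarith
    have g0 := g_nonneg hσ ya yaσ
    have g1 : g (y a) σ ≤ 1 := (g_le_self hσ ya yaσ).trans (by linarith)
    have G0 := g_nonneg hσ hY (by linarith)
    have st1 := ih (fun i hi => hy i (Finset.mem_insert_of_mem hi)) (by linarith)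
      (fun t => φ t * (1 - t * g (y a) σ)) (by fun_prop)
      (antitoneOn_mul_nonneg hφa (antitoneOn_one_sub_mul g0 _) hφ0
        (fun t ht => one_sub_mul_nonneg g0 g1 ht))
      (fun t ht => mul_nonneg (hφ0 t ht) (one_sub_mul_nonneg g0 g1 ht))
    have st2 := integral_weight_le (φ := φ)
      (h := fun t => (1 - t * g (y a) σ) * (1 - t * g (∑ i ∈ s, y i) σ))
      (f := fun t => 1 - t * g (y a + ∑ i ∈ s, y i) σ) (c := g (y a) σ * g (∑ i ∈ s, y i) σ)
      hφ (by fun_prop) (by fun_prop) hφa hφ0 (mul_nonneg g0 G0)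
      -- Expanding the product leaves `t * (g a + g b - g (a + b)) - t ^ 2 * g a * g b`, and
      -- `g_add_le` bounds the first part below by `2/3 * t * g a * g b`.
      (by
        intro t ht
        have := mul_le_mul_of_nonneg_left (g_add_le hσ hσ1 ya hY hs) ht.1
        nlinarith)
    calc _ = ∫ t in (0 : ℝ)..1, φ t * (1 - t * g (y a) σ) * ∏ i ∈ s, (1 - t * g (y i) σ) := by
          refine intervalIntegral.integral_congr fun t _ => ?_
          rw [Finset.prod_insert has, mul_assoc]
      _ ≤ _ := st1
      _ = _ := intervalIntegral.integral_congr fun t _ => by ring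
      _ ≤ _ := st2

/-- The identity `g x σ * F (σ - x) = x * F σ`, for which `g` is made. -/
theorem g_mul_integral_exp (hσ : 0 < σ) {x : ℝ} :
    g x σ * ∫ t in (0 : ℝ)..1, Real.exp (-(t * (σ - x))) = (1 - Real.exp (-σ)) * x / σ := by
  by_cases h : x = σ
  · simp [h, g]; field_simp
  · have hs : σ - x ≠ 0 := sub_ne_zero.2 (Ne.symm h)
    have hI : ∫ t in (0 : ℝ)..1, Real.exp (-(t * (σ - x)))
        = (1 - Real.exp (-(σ - x))) / (σ - x) := by
      have hd : ∀ t ∈ Set.uIcc (0 : ℝ) 1, HasDerivAt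
          (fun t : ℝ => -Real.exp (-(t * (σ - x))) / (σ - x)) (Real.exp (-(t * (σ - x)))) t := by
        intro t _
        have := ((((hasDerivAt_id t).mul_const (σ - x)).neg.exp).neg).div_const (σ - x)
        refine this.congr_deriv ?_
        field_simp; simp [mul_comm]
      rw [intervalIntegral.integral_eq_sub_of_hasDerivAt hd
        (Continuous.intervalIntegrable (by fun_prop) _ _)]
      simp
      ring
    have h1 : Real.exp σ - Real.exp x ≠ 0 :=
      sub_ne_zero.2 fun hh => h (Real.exp_injective hh).symm
    have h2 := (Real.exp_pos σ).ne'
    rw [hI, g, if_neg h, neg_sub, Real.exp_sub, Real.exp_neg]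
    field_simp

theorem g_mul_integral_prod_bounds [Fintype ι] [DecidableEq ι] (hσ : 0 < σ) (hσ1 : σ ≤ 1)
    (y : ι → ℝ) (hy : ∀ i, 0 ≤ y i) (hs : ∑ i, y i = σ) (j : ι) :
    (1 - Real.exp (-σ)) * y j / σ
        ≤ g (y j) σ * ∫ t in (0 : ℝ)..1, ∏ i ∈ Finset.univ.erase j, (1 - t * g (y i) σ) ∧
      g (y j) σ * ∫ t in (0 : ℝ)..1, ∏ i ∈ Finset.univ.erase j, (1 - t * g (y i) σ)
        ≤ y j * (1 + Real.exp (-σ)) / 2 := by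
  have hle : ∀ i, y i ≤ σ := fun i => hs ▸ Finset.single_le_sum (fun k _ => hy k) (Finset.mem_univ i)
  have hsum : ∑ i ∈ Finset.univ.erase j, y i = σ - y j := by
    rw [← hs, ← Finset.sum_erase_add _ _ (Finset.mem_univ j)]; ring
  have hg := g_nonneg hσ (hy j) (hle j)
  constructor
  · rw [← g_mul_integral_exp hσ]
    refine mul_le_mul_of_nonneg_left ?_ hg
    have := integral_exp_le_integral_prod hσ hσ1 y (Finset.univ.erase j)
      (fun i _ => ⟨hy i, hle i⟩) (fun _ => 1) continuous_const antitoneOn_const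
      (fun _ _ => zero_le_one)
    simpa only [one_mul, hsum] using this
  · refine le_trans (mul_le_mul_of_nonneg_left ?_ hg) (g_mul_le hσ hσ1 (hy j) (hle j))
    have := integral_prod_le hσ hσ1 y (Finset.univ.erase j)
      (fun i _ => hy i) (by rw [hsum]; linarith [hy j]) (fun _ => 1) continuous_const
      antitoneOn_const (fun _ _ => zero_le_one)
    simp only [one_mul, hsum] at this
    refine this.trans (le_of_eq ?_)
    rw [intervalIntegral.integral_sub, intervalIntegral.integral_mul_const, integral_id]
    · simp; ring
    · simp
    · exact Continuous.intervalIntegrable (by fun_prop) _ _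

end Products

/-! ### Discrete distributions -/

theorem pmf_bind_congr {α β : Type*} (P : PMF α) {f h : α → PMF β}
    (hfh : ∀ a ∈ P.support, f a = h a) : P.bind f = P.bind h := by
  ext b
  simp only [PMF.bind_apply]
  refine tsum_congr fun a => ?_
  by_cases ha : P a = 0
  · simp [ha]
  · rw [hfh a ((PMF.mem_support_iff _ _).2 ha)]

theorem pmf_sum_toReal {α : Type*} [Fintype α] (P : PMF α) : ∑ a, (P a).toReal = 1 := by
  rw [← ENNReal.toReal_sum (fun a _ => PMF.apply_ne_top P a), ← tsum_fintype (L := .unconditional _),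
    PMF.tsum_coe, ENNReal.toReal_one]

theorem bool_bind_apply {β : Type*} (P : PMF Bool) (f : Bool → PMF β) (b : β) :
    P.bind f b = P true * f true b + P false * f false b := by
  rw [PMF.bind_apply, tsum_bool, add_comm]

section Sampling

variable {V W : Type*} [DecidableEq V] [DecidableEq W]

theorem coin_true (q : unitInterval) : coin q true = ENNReal.ofReal (q : ℝ) := by
  simp [coin]

theorem coin_false (q : unitInterval) : coin q false = ENNReal.ofReal (1 - (q : ℝ)) := by
  simp [coin]

/-! ### The realized subgraph edge by edge -/

theorem realized_apply (E : Finset (V × W)) (p : V × W → unitInterval) (R : Finset (V × W)) :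
    realized E p R = if R ⊆ E then
        (∏ e ∈ R, ENNReal.ofReal (p e : ℝ)) * ∏ e ∈ E \ R, ENNReal.ofReal (1 - (p e : ℝ))
      else 0 := by
  simp [realized, PMF.ofFinset_apply]

theorem subset_of_mem_support_realized {E : Finset (V × W)} {p : V × W → unitInterval}
    {R : Finset (V × W)} (h : R ∈ (realized E p).support) : R ⊆ E := by
  by_contra hR
  exact (PMF.mem_support_iff _ _).1 h (by rw [realized_apply, if_neg hR])

theorem map_insert_realized_apply {E : Finset (V × W)} (p : V × W → unitInterval) {e : V × W}
    (he : e ∉ E) (R : Finset (V × W)) :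
    (realized E p).map (insert e) R = if e ∈ R then realized E p (R.erase e) else 0 := by
  rw [PMF.map_apply]
  split_ifs with h
  · rw [tsum_eq_single (R.erase e), if_pos (Finset.insert_erase h).symm]
    intro R' hR'
    split_ifs with hR
    · have : e ∈ R' := by
        by_contra h'
        exact hR' (by rw [hR, Finset.erase_insert h'])
      rw [realized_apply, if_neg fun hs => he (hs this)]
    · rfl
  · refine ENNReal.tsum_eq_zero.2 fun R' => if_neg fun hR => h ?_
    rw [hR]; exact Finset.mem_insert_self e R'

theorem realized_insert {E : Finset (V × W)} (p : V × W → unitInterval) {e : V × W} (he : e ∉ E) :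
    realized (insert e E) p = (coin (p e)).bind fun b =>
      if b then (realized E p).map (insert e) else realized E p := by
  ext R
  rw [bool_bind_apply, coin_true, coin_false]
  simp only [if_true, Bool.false_eq_true, if_false]
  rw [map_insert_realized_apply p he]
  by_cases h : e ∈ R
  · have h0 : realized E p R = 0 := by rw [realized_apply, if_neg fun hs => he (hs h)]
    rw [if_pos h, h0, mul_zero, add_zero, realized_apply, realized_apply]
    have hiff : R ⊆ insert e E ↔ R.erase e ⊆ E := by rw [Finset.subset_insert_iff]
    by_cases hR : R.erase e ⊆ E
    · rw [if_pos (hiff.2 hR), if_pos hR, ← Finset.mul_prod_erase R _ h, mul_assoc]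
      have : insert e E \ R = E \ R.erase e := by
        ext f
        simp only [Finset.mem_sdiff, Finset.mem_insert, Finset.mem_erase]
        constructor
        · rintro ⟨rfl | hf, hfR⟩
          · exact absurd h hfR
          · exact ⟨hf, fun hh => hfR hh.2⟩
        · rintro ⟨hf, hfR⟩
          refine ⟨Or.inr hf, fun hh => hfR ⟨?_, hh⟩⟩
          rintro rfl; exact he hf
      rw [this]
    · rw [if_neg fun hh => hR (hiff.1 hh), if_neg hR, mul_zero]
  · rw [if_neg h, mul_zero, zero_add, realized_apply, realized_apply]
    have hiff : R ⊆ insert e E ↔ R ⊆ E := Finset.subset_insert_iff_of_notMem h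
    by_cases hR : R ⊆ E
    · rw [if_pos (hiff.2 hR), if_pos hR, Finset.insert_sdiff_of_notMem _ h,
        Finset.prod_insert (fun hh => he (Finset.mem_sdiff.1 hh).1)]
      ring
    · rw [if_neg fun hh => hR (hiff.1 hh), if_neg hR, mul_zero]

theorem realized_eq_erase {E : Finset (V × W)} (p : V × W → unitInterval) {e : V × W}
    (he : e ∈ E) :
    realized E p = (coin (p e)).bind fun b =>
      if b then (realized (E.erase e) p).map (insert e) else realized (E.erase e) p := by
  conv_lhs => rw [← Finset.insert_erase he]
  exact realized_insert p (Finset.notMem_erase e E)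

theorem realized_bind_eq_erase {β : Type*} {E : Finset (V × W)} (p : V × W → unitInterval)
    {e : V × W} (he : e ∈ E) (f : Finset (V × W) → PMF β) :
    (realized E p).bind f = (coin (p e)).bind fun b =>
      (realized (E.erase e) p).bind fun R => f (if b then insert e R else R) := by
  rw [realized_eq_erase p he, PMF.bind_bind]
  congr 1; funext b
  cases b
  · simp
  · simp [PMF.bind_map, Function.comp_def]

/-- Averages over the realized subgraph of functions insensitive to `e` do not see `e`. -/
theorem realized_erase_bind {β : Type*} {E : Finset (V × W)} (p : V × W → unitInterval)
    {e : V × W} (he : e ∈ E) {f : Finset (V × W) → PMF β} (hf : ∀ R, f (insert e R) = f R) :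
    (realized (E.erase e) p).bind f = (realized E p).bind f := by
  rw [realized_bind_eq_erase p he]
  have : ∀ b : Bool, ((realized (E.erase e) p).bind fun R => f (if b then insert e R else R))
      = (realized (E.erase e) p).bind f := by
    intro b
    cases b <;> simp [hf]
  simp only [this, PMF.bind_const]

/-! ### Deferred decisions -/

/-- The first edge of a list whose independent coin shows "realized". -/
noncomputable def coinFirst (p : V × W → unitInterval) : List (V × W) → PMF (Option (V × W))
  | [] => PMF.pure none
  | e :: l => (coin (p e)).bind fun b => if b then PMF.pure (some e) else coinFirst p l

/-- In a duplicate-free list each edge is looked up at most once, so its status can be drawn at that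
moment. -/
theorem realized_bind_find (p : V × W → unitInterval) (l : List (V × W)) (hl : l.Nodup) :
    ∀ E : Finset (V × W), (∀ e ∈ l, e ∈ E) →
      ((realized E p).bind fun R => PMF.pure (l.find? fun e => decide (e ∈ R))) = coinFirst p l := by
  induction l with
  | nil => intro E _; simp [coinFirst]
  | cons e l ih =>
    intro E hE
    rw [List.nodup_cons] at hl
    rw [realized_bind_eq_erase p (hE e List.mem_cons_self), coinFirst]
    congr 1; funext b
    cases b
    · simp only [Bool.false_eq_true, if_false]
      rw [← ih hl.2 (E.erase e) fun f hf => Finset.mem_erase.2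
        ⟨fun h => hl.1 (h ▸ hf), hE f (List.mem_cons_of_mem _ hf)⟩]
      refine pmf_bind_congr _ fun R hR => ?_
      have : e ∉ R := fun h => Finset.notMem_erase e E (subset_of_mem_support_realized hR h)
      rw [List.find?_cons_of_neg (by simpa using this)]
    · simp

omit [DecidableEq V] [DecidableEq W] in
theorem coinFirst_apply_eq_zero (p : V × W → unitInterval) {l : List (V × W)} {e : V × W}
    (he : e ∉ l) : coinFirst p l (some e) = 0 := by
  induction l with
  | nil => simp [coinFirst]
  | cons f l ih =>
    rw [List.mem_cons, not_or] at he
    rw [coinFirst, bool_bind_apply]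
    simp [he.1, ih he.2]

/-- The matching after a proposal (or none) has been made. -/
def addProposal (M : Finset (V × W)) : Option (V × W) → Finset (V × W)
  | none => M
  | some e => if FreeR M e.2 then insert e M else M

/-- Here `K` stands for the rest of the process, which never looks at the edges of `l`. A queried
edge is therefore revealed once and its status can be resampled afterwards; a blocked edge uses a
coin independent of `R`. Either way a fresh coin decides, so the proposal does not depend on `M`. -/
theorem realized_bind_propose {β : Type*} (p : V × W → unitInterval) (M : Finset (V × W))
    (K : Finset (V × W) → Finset (V × W) → PMF β) (l : List (V × W)) (hl : l.Nodup)
    (hK : ∀ e ∈ l, ∀ R M', K (insert e R) M' = K R M') :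
    ∀ E : Finset (V × W), (∀ e ∈ l, e ∈ E) →
      ((realized E p).bind fun R => (propose p R M l).bind (K R)) =
        (coinFirst p l).bind fun o => (realized E p).bind fun R => K R (addProposal M o) := by
  induction l with
  | nil => intro E _; simp [propose, coinFirst, addProposal]
  | cons e l ih =>
    intro E hE
    rw [List.nodup_cons] at hl
    have heE := hE e List.mem_cons_self
    have ih' := ih hl.2 (fun f hf => hK f (List.mem_cons_of_mem _ hf))
    have hKe := hK e List.mem_cons_self
    rw [coinFirst, PMF.bind_bind]
    by_cases hfree : FreeL M e.1 ∧ FreeR M e.2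
    · rw [realized_bind_eq_erase p heE]
      congr 1; funext b
      cases b
      · simp only [Bool.false_eq_true, if_false]
        have h1 : ((realized (E.erase e) p).bind fun R => (propose p R M (e :: l)).bind (K R))
            = (realized (E.erase e) p).bind fun R => (propose p R M l).bind (K R) := by
          refine pmf_bind_congr _ fun R hR => ?_
          have : e ∉ R := fun h => Finset.notMem_erase e E (subset_of_mem_support_realized hR h)
          simp [propose, examine, hfree, this]
        rw [h1, ih' (E.erase e) fun f hf => Finset.mem_erase.2
          ⟨fun h => hl.1 (h ▸ hf), hE f (List.mem_cons_of_mem _ hf)⟩]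
        congr 1; funext o
        -- The revealed edge `e` is put back as a fresh random edge, which `K` cannot notice.
        exact realized_erase_bind p heE fun R => hKe R _
      · simp only [if_true, PMF.pure_bind]
        rw [← realized_erase_bind p heE (fun R => hKe R _)]
        congr 1; funext R
        simp [propose, examine, hfree, addProposal, hKe]
    · simp only [propose, examine, if_neg hfree, PMF.bind_bind]
      rw [PMF.bind_comm]
      congr 1; funext b
      cases b
      · simpa using ih' E fun f hf => hE f (List.mem_cons_of_mem _ hf)
      · simp [addProposal]

theorem propose_insert (p : V × W → unitInterval) (R M : Finset (V × W)) {e : V × W}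
    {l : List (V × W)} (he : e ∉ l) : propose p (insert e R) M l = propose p R M l := by
  induction l with
  | nil => rfl
  | cons f l ih =>
    rw [List.mem_cons, not_or] at he
    simp only [propose, ih he.2]
    congr 1
    simp [examine, Ne.symm he.1]

theorem process_insert (p : V × W → unitInterval) (Q : V → PMF (List (V × W)))
    (R : Finset (V × W)) {e : V × W} {vs : List V}
    (he : ∀ v ∈ vs, ∀ l ∈ (Q v).support, e ∉ l) (M : Finset (V × W)) :
    process p Q (insert e R) vs M = process p Q R vs M := by
  induction vs generalizing M with
  | nil => rfl
  | cons v vs ih =>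
    simp only [process]
    refine pmf_bind_congr _ fun l hl => ?_
    rw [propose_insert p R M (he v List.mem_cons_self l hl)]
    congr 1; funext M'
    exact ih (fun w hw => he w (List.mem_cons_of_mem _ hw)) M'

/-- The matching process in which the proposal made by `v` is drawn from `S v`. -/
noncomputable def proposalProcess (S : V → PMF (Option (V × W))) :
    List V → Finset (V × W) → PMF (Finset (V × W))
  | [], M => PMF.pure M
  | v :: vs, M => (S v).bind fun o => proposalProcess S vs (addProposal M o)

theorem realized_bind_process {E : Finset (V × W)} (p : V × W → unitInterval)
    (Q : V → PMF (List (V × W)))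
    (hQ : ∀ v, ∀ l ∈ (Q v).support, l.Nodup ∧ ∀ e ∈ l, e ∈ edgesL E v)
    (vs : List V) (hvs : vs.Nodup) (M : Finset (V × W)) :
    ((realized E p).bind fun R => process p Q R vs M) =
      proposalProcess (fun v => (Q v).bind (coinFirst p)) vs M := by
  induction vs generalizing M with
  | nil => simp [process, proposalProcess]
  | cons v vs ih =>
    rw [List.nodup_cons] at hvs
    simp only [process, proposalProcess]
    rw [PMF.bind_comm, PMF.bind_bind]
    refine pmf_bind_congr _ fun l hl => ?_
    obtain ⟨hnd, hmem⟩ := hQ v l hl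
    rw [realized_bind_propose p M (fun R M' => process p Q R vs M') l hnd ?_ E
      (fun e he => (Finset.mem_filter.1 (hmem e he)).1)]
    · congr 1; funext o
      exact ih hvs.2 _
    -- Each edge has one left end-point, and `v` does not recur in `vs`, so later lists avoid the
    -- edges of `v`.
    · intro e he R M'
      refine process_insert p Q R (fun w hw l' hl' hel' => ?_) M'
      have h1 := (Finset.mem_filter.1 (hmem e he)).2
      have h2 := (Finset.mem_filter.1 ((hQ w l' hl').2 e hel')).2
      exact hvs.1 (by rw [← h1, h2]; exact hw)

/-! ### Thinning -/

instance : Fintype Verdict :=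
  ⟨⟨([Verdict.halt, Verdict.append, Verdict.skip] : List Verdict), by simp⟩,
    fun a => by cases a <;> simp⟩

theorem verdict_sum {M : Type*} [AddCommMonoid M] (f : Verdict → M) :
    ∑ a, f a = f .halt + f .append + f .skip := by
  change ([f .halt, f .append, f .skip]).sum = _
  simp [add_assoc]

section Verdicts

variable {q r : ℝ} (hq0 : 0 ≤ q) (hq1 : q ≤ 1) (hr0 : 0 ≤ r) (hr1 : r ≤ 1)
include hq0 hq1 hr0 hr1

theorem randomVerdict_values :
    randomVerdict q r .append = ENNReal.ofReal r ∧
      randomVerdict q r .skip = ENNReal.ofReal ((1 - q) * (1 - r)) := by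
  have ha : q * (1 - r) ∈ unitInterval :=
    ⟨mul_nonneg hq0 (by linarith), by nlinarith⟩
  have hb : q * (1 - r) + r ∈ unitInterval :=
    ⟨add_nonneg ha.1 hr0, by nlinarith⟩
  have hv : ∀ a, randomVerdict q r a = volume (verdict q r ⁻¹' {a}) := by
    intro a
    rw [randomVerdict, Measure.toPMF_apply, Measure.map_apply (measurable_verdict q r)
      (measurableSet_singleton a)]
  have h2 : verdict q r ⁻¹' {.append} =
      Set.Ioc (⟨_, ha⟩ : unitInterval) (⟨_, hb⟩ : unitInterval) := by
    ext c
    simp only [Set.mem_preimage, Set.mem_singleton_iff, Set.mem_Ioc, verdict, ← Subtype.coe_le_coe,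
      ← Subtype.coe_lt_coe]
    split_ifs <;> simp_all
  have h3 : verdict q r ⁻¹' {.skip} = Set.Ioi (⟨_, hb⟩ : unitInterval) := by
    ext c
    simp only [Set.mem_preimage, Set.mem_singleton_iff, Set.mem_Ioi, verdict,
      ← Subtype.coe_lt_coe]
    split_ifs with h h'
    · simp; linarith
    · simp; linarith
    · simp; linarith
  rw [hv, hv, h2, h3, unitInterval.volume_Ioc, unitInterval.volume_Ioi]
  constructor
  · congr 1; simp
  · congr 1; simp only; ring

end Verdicts

omit [DecidableEq V] [DecidableEq W] in
theorem sublist_of_mem_support_thin (p : V × W → unitInterval) (x xt : V × W → ℝ)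
    (l : List (V × W)) : ∀ l' ∈ (thin p x xt l).support, l'.Sublist l := by
  induction l with
  | nil => intro l' hl'; simp [thin] at hl'; simp [hl']
  | cons e l ih =>
    intro l' hl'
    rw [thin, PMF.mem_support_bind_iff] at hl'
    obtain ⟨a, -, ha⟩ := hl'
    cases a
    · simp at ha; simp [ha]
    · simp only [PMF.mem_support_map_iff] at ha
      obtain ⟨l'', h1, rfl⟩ := ha
      exact (ih l'' h1).cons_cons e
    · exact (ih l' ha).cons e

/-- Thinning does not change the chance of getting past an edge with probability `q` and ratio `r`:
appended but not realized has probability `r * (1 - q)`, skipped has `(1 - q) * (1 - r)`, and the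
sum is `1 - q`. Only the final success is scaled, from `q` to `r * q`. -/
theorem thin_bind_coinFirst (p : V × W → unitInterval) (x xt : V × W → ℝ) (l : List (V × W))
    (hr : ∀ e ∈ l, 0 ≤ xt e / x e ∧ xt e / x e ≤ 1) (e : V × W) :
    (thin p x xt l).bind (coinFirst p) (some e) =
      ENNReal.ofReal (xt e / x e) * coinFirst p l (some e) := by
  induction l with
  | nil => simp [thin, coinFirst]
  | cons f l ih =>
    have ih' := ih fun f hf => hr f (List.mem_cons_of_mem _ hf)
    obtain ⟨r0, r1⟩ := hr f List.mem_cons_self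
    obtain ⟨hA, hS⟩ := randomVerdict_values (p f).2.1 (p f).2.2 r0 r1
    have happ : ((thin p x xt l).map fun l' => f :: l').bind (coinFirst p) (some e) =
        ENNReal.ofReal (p f : ℝ) * (PMF.pure (some f) : PMF (Option (V × W))) (some e) +
          ENNReal.ofReal (1 - (p f : ℝ)) *
            (ENNReal.ofReal (xt e / x e) * coinFirst p l (some e)) := by
      rw [PMF.bind_map]
      simp only [Function.comp_def, coinFirst]
      rw [PMF.bind_comm, bool_bind_apply, coin_true, coin_false]
      simp only [if_true, Bool.false_eq_true, if_false, PMF.bind_const]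
      rw [← ih']
    have hsum : ENNReal.ofReal (xt f / x f) * ENNReal.ofReal (1 - (p f : ℝ)) +
        ENNReal.ofReal ((1 - (p f : ℝ)) * (1 - xt f / x f)) = ENNReal.ofReal (1 - (p f : ℝ)) := by
      have hp := sub_nonneg.2 (p f).2.2
      rw [← ENNReal.ofReal_mul r0, ← ENNReal.ofReal_add (mul_nonneg r0 hp)
        (mul_nonneg hp (by linarith))]
      congr 1; ring
    have hpure : ENNReal.ofReal (xt f / x f) *
          (PMF.pure (some f) : PMF (Option (V × W))) (some e) =
        ENNReal.ofReal (xt e / x e) * (PMF.pure (some f) : PMF (Option (V × W))) (some e) := by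
      by_cases h : e = f
      · rw [h]
      · simp [h]
    rw [thin, PMF.bind_bind, PMF.bind_apply, tsum_fintype, verdict_sum]
    simp only [PMF.pure_bind]
    rw [happ, ih', hA, hS]
    have hcons : coinFirst p (f :: l) (some e) =
        ENNReal.ofReal (p f : ℝ) * (PMF.pure (some f) : PMF (Option (V × W))) (some e) +
          ENNReal.ofReal (1 - (p f : ℝ)) * coinFirst p l (some e) := by
      rw [coinFirst, bool_bind_apply, coin_true, coin_false]
      simp only [if_true, Bool.false_eq_true, if_false]
    rw [hcons, coinFirst]
    rw [show (PMF.pure none : PMF (Option (V × W))) (some e) = 0 by simp, mul_zero, zero_add]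
    set P := (PMF.pure (some f) : PMF (Option (V × W))) (some e)
    set T := coinFirst p l (some e)
    calc _ = ENNReal.ofReal (p f : ℝ) * (ENNReal.ofReal (xt f / x f) * P) +
          (ENNReal.ofReal (xt f / x f) * ENNReal.ofReal (1 - (p f : ℝ)) +
            ENNReal.ofReal ((1 - (p f : ℝ)) * (1 - xt f / x f))) *
            (ENNReal.ofReal (xt e / x e) * T) := by ring
      _ = _ := by rw [hsum, hpure]; ring

theorem firstRealized_eq {E : Finset (V × W)} {p : V × W → unitInterval} {x : V × W → ℝ} {v : V}
    {D : PMF (List (V × W))} (hD : IsProportional E p x v D) :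
    firstRealized E p D = D.bind (coinFirst p) := by
  refine pmf_bind_congr _ fun l hl => realized_bind_find p l (hD.perm l hl).1 E fun e he => ?_
  exact (Finset.mem_filter.1 ((hD.perm l hl).2 e he)).1

/-! ### The law of a single proposal -/

section Proposal

variable {E : Finset (V × W)} {p : V × W → unitInterval} {x xt : V × W → ℝ} {v : V}
  {D : PMF (List (V × W))} (hD : IsProportional E p x v D)
include hD

theorem proposalDist_support {l : List (V × W)} (hl : l ∈ (proposalDist p x xt D).support) :
    l.Nodup ∧ ∀ e ∈ l, e ∈ edgesL E v := by
  obtain ⟨l', h1, h2⟩ := (PMF.mem_support_bind_iff _ _ _).1 hl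
  have hs := sublist_of_mem_support_thin p x xt l' l h2
  exact ⟨(hD.perm l' h1).1.sublist hs, fun e he => (hD.perm l' h1).2 e (hs.subset he)⟩

theorem proposalDist_bind_coinFirst
    (hr : ∀ e ∈ edgesL E v, 0 ≤ xt e / x e ∧ xt e / x e ≤ 1) (e : V × W) :
    (proposalDist p x xt D).bind (coinFirst p) (some e) =
      if e ∈ edgesL E v then ENNReal.ofReal (xt e / x e) * ENNReal.ofReal (x e) else 0 := by
  have h1 : (proposalDist p x xt D).bind (coinFirst p) (some e) =
      ENNReal.ofReal (xt e / x e) * D.bind (coinFirst p) (some e) := by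
    rw [proposalDist, PMF.bind_bind, PMF.bind_apply, PMF.bind_apply, ← ENNReal.tsum_mul_left]
    refine tsum_congr fun l => ?_
    by_cases hl : D l = 0
    · simp [hl]
    · rw [thin_bind_coinFirst p x xt l
        fun f hf => hr f ((hD.perm l ((PMF.mem_support_iff _ _).2 hl)).2 f hf)]
      ring
  rw [h1]
  split_ifs with he
  · rw [← hD.prob e he, firstRealized_eq hD]
  · refine mul_eq_zero_of_right _ ?_
    rw [PMF.bind_apply, ENNReal.tsum_eq_zero]
    intro l
    by_cases hl : D l = 0
    · simp [hl]
    · rw [coinFirst_apply_eq_zero p fun hel =>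
        he ((hD.perm l ((PMF.mem_support_iff _ _).2 hl)).2 e hel), mul_zero]

end Proposal

end Sampling

section RandomOrder

variable {V W : Type*} [DecidableEq V] [DecidableEq W]

/-! ### Membership probabilities -/

omit [DecidableEq V] [DecidableEq W] in
theorem probMem_pure (M : Finset (V × W)) (e : V × W) [Decidable (e ∈ M)] :
    probMem (PMF.pure M) e = if e ∈ M then 1 else 0 := by
  rw [probMem, PMF.toOuterMeasure_pure_apply]
  by_cases h : e ∈ M <;> simp [h]

omit [DecidableEq V] [DecidableEq W] in
theorem probMem_bind {α : Type*} [Fintype α] (P : PMF α) (f : α → PMF (Finset (V × W)))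
    (e : V × W) : probMem (P.bind f) e = ∑ a, (P a).toReal * probMem (f a) e := by
  simp only [probMem]
  rw [PMF.toOuterMeasure_bind_apply, tsum_fintype, ENNReal.toReal_sum]
  · simp only [ENNReal.toReal_mul]
  · intro a _
    refine ENNReal.mul_ne_top (PMF.apply_ne_top P a) ?_
    refine ne_top_of_le_ne_top ENNReal.one_ne_top ?_
    rw [PMF.toOuterMeasure_apply, ← (f a).tsum_coe]
    exact ENNReal.tsum_le_tsum fun b => Set.indicator_le_self _ _ _

/-! ### The process for a fixed order -/

/-- The probability that `v` succeeds before any earlier vertex of the list does, when each vertex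
`w` succeeds independently with probability `q w`. -/
def firstProb (q : V → ℝ) (v : V) : List V → ℝ
  | [] => 0
  | w :: vs => (if w = v then q w else 0) + (1 - q w) * firstProb q v vs

theorem firstProb_eq_zero (q : V → ℝ) {v : V} {l : List V} (h : v ∉ l) : firstProb q v l = 0 := by
  induction l with
  | nil => rfl
  | cons w l ih =>
    rw [List.mem_cons, not_or] at h
    simp [firstProb, ih h.2, Ne.symm h.1]

/-- The factors are written as `1 + (-q w or 0)`, over all of `V`, so that `Finset.prod_one_add` can
expand them over subsets when the order is averaged. -/
theorem firstProb_eq_prod [Fintype V] (q : V → ℝ) {v : V} {l : List V} (hl : l.Nodup) (h : v ∈ l) :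
    firstProb q v l =
      q v * ∏ w, (1 + if l.idxOf w < l.idxOf v then -q w else 0) := by
  induction l with
  | nil => simp at h
  | cons w l ih =>
    rw [List.nodup_cons] at hl
    by_cases hw : w = v
    · subst hw
      simp [firstProb, firstProb_eq_zero q hl.1]
    · have hv : v ∈ l := by
        rcases List.mem_cons.1 h with h | h
        · exact absurd h.symm hw
        · exact h
      rw [firstProb, if_neg hw, zero_add, ih hl.2 hv,
        ← Finset.mul_prod_erase Finset.univ _ (Finset.mem_univ w),
        ← Finset.mul_prod_erase Finset.univ
          (fun u => 1 + if (w :: l).idxOf u < (w :: l).idxOf v then -q u else 0)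
          (Finset.mem_univ w)]
      -- `idxOf` of an absent element is the length of the list, so such an element never counts as
      -- earlier.
      have h1 : ¬ l.idxOf w < l.idxOf v := by
        rw [List.idxOf_eq_length_iff.2 hl.1]
        exact not_lt.2 List.idxOf_le_length
      rw [if_neg h1, List.idxOf_cons_self, List.idxOf_cons_ne _ hw, if_pos (Nat.succ_pos _)]
      have h2 : ∏ u ∈ Finset.univ.erase w,
            (1 + if (w :: l).idxOf u < Nat.succ (l.idxOf v) then -q u else 0) =
          ∏ u ∈ Finset.univ.erase w, (1 + if l.idxOf u < l.idxOf v then -q u else 0) := by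
        refine Finset.prod_congr rfl fun u hu => ?_
        rw [List.idxOf_cons_ne _ (Finset.ne_of_mem_erase hu).symm]
        simp only [Nat.succ_lt_succ_iff]
      rw [h2]
      ring

theorem freeR_addProposal {M : Finset (V × W)} {u : W} (hM : FreeR M u) {o : Option (V × W)}
    (ho : ∀ f, o = some f → f.2 ≠ u) : FreeR (addProposal M o) u := by
  cases o with
  | none => exact hM
  | some f =>
    simp only [addProposal]
    split_ifs
    · intro f' hf'
      rcases Finset.mem_insert.1 hf' with rfl | h
      · exact ho _ rfl
      · exact hM f' h
    · exact hM

variable [Fintype V] [Fintype W] (S : V → PMF (Option (V × W)))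

theorem probMem_proposalProcess_of_mem (e : V × W) (vs : List V) {M : Finset (V × W)}
    (he : e ∈ M) : probMem (proposalProcess S vs M) e = 1 := by
  induction vs generalizing M with
  | nil => simp [proposalProcess, probMem_pure, he]
  | cons v vs ih =>
    rw [proposalProcess, probMem_bind]
    have : ∀ o, e ∈ addProposal M o := by
      intro o
      cases o with
      | none => exact he
      | some f =>
        simp only [addProposal]
        split_ifs
        · exact Finset.mem_insert_of_mem he
        · exact he
    simp only [ih (this _), mul_one, pmf_sum_toReal]

theorem probMem_proposalProcess_of_not_free (e : V × W) (vs : List V) {M : Finset (V × W)}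
    (he : e ∉ M) (hM : ¬ FreeR M e.2) : probMem (proposalProcess S vs M) e = 0 := by
  induction vs generalizing M with
  | nil => simp [proposalProcess, probMem_pure, he]
  | cons v vs ih =>
    rw [proposalProcess, probMem_bind]
    have : ∀ o, e ∉ addProposal M o ∧ ¬ FreeR (addProposal M o) e.2 := by
      intro o
      cases o with
      | none => exact ⟨he, hM⟩
      | some f =>
        simp only [addProposal]
        split_ifs with h
        · refine ⟨fun hh => ?_, fun hh => hM fun f' hf' => hh f' (Finset.mem_insert_of_mem hf')⟩
          rcases Finset.mem_insert.1 hh with rfl | h'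
          · exact hM h
          · exact he h'
        · exact ⟨he, hM⟩
    simp only [ih (this _).1 (this _).2, mul_zero, Finset.sum_const_zero]

/-- While `u = e.2` is free, only a proposal to `u` matters: by `e.1` it puts `e` in the matching
for good, by another vertex it excludes `e` for good. Any other outcome keeps `u` free. -/
theorem probMem_proposalProcess (hS : ∀ v f, f.1 ≠ v → S v (some f) = 0) (e : V × W)
    (vs : List V) {M : Finset (V × W)} (hM : FreeR M e.2) :
    probMem (proposalProcess S vs M) e =
      firstProb (fun w => (S w (some (w, e.2))).toReal) e.1 vs := by
  induction vs generalizing M with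
  | nil =>
    have : e ∉ M := fun h => hM e h rfl
    simp [proposalProcess, probMem_pure, firstProb, this]
  | cons v vs ih =>
    rw [proposalProcess, probMem_bind, firstProb]
    set F := firstProb (fun w => (S w (some (w, e.2))).toReal) e.1 vs
    set o' : Option (V × W) := some (v, e.2) with ho'
    have h1 : probMem (proposalProcess S vs (addProposal M o')) e = if v = e.1 then 1 else 0 := by
      rw [ho', addProposal, if_pos hM]
      split_ifs with h
      · exact probMem_proposalProcess_of_mem S e vs (by rw [h]; simp)
      · refine probMem_proposalProcess_of_not_free S e vs (fun hh => ?_) fun hh => ?_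
        · rcases Finset.mem_insert.1 hh with h' | h'
          · exact h (by rw [h'])
          · exact hM e h' rfl
        · exact hh _ (Finset.mem_insert_self _ _) rfl
    have h2 : ∀ o ∈ Finset.univ.erase o', (S v o).toReal *
        probMem (proposalProcess S vs (addProposal M o)) e = (S v o).toReal * F := by
      intro o ho
      by_cases h0 : S v o = 0
      · simp [h0]
      · rw [ih (freeR_addProposal hM ?_)]
        rintro f rfl hf
        have hfv : f.1 = v := by
          by_contra hh; exact h0 (hS v f hh)
        exact Finset.ne_of_mem_erase ho (by rw [ho', ← hf, ← hfv])
    have h3 := pmf_sum_toReal (S v)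
    rw [← Finset.add_sum_erase _ _ (Finset.mem_univ o')] at h3 ⊢
    rw [h1, Finset.sum_congr rfl h2, ← Finset.sum_mul,
      show ∑ o ∈ Finset.univ.erase o', (S v o).toReal = 1 - (S v o').toReal by linarith]
    split_ifs <;> ring

end RandomOrder

/-! ### Averaging over the order -/

section Average

variable {V : Type*} [Fintype V] [DecidableEq V]

/-- By symmetry each element of `insert v T` is equally likely to come last. `N s` collects the
orders in which `s` is last; these sets partition all orders, and composing with `Equiv.swap s v`
matches `N s` with `N v`. -/
theorem card_before_mul (T : Finset V) {v : V} (hv : v ∉ T) :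
    (Finset.univ.filter fun π : Fin (Fintype.card V) ≃ V =>
        ∀ w ∈ T, π.symm w < π.symm v).card * (T.card + 1) =
      Fintype.card (Fin (Fintype.card V) ≃ V) := by
  set n := Fintype.card V
  set N : V → Finset (Fin n ≃ V) := fun s =>
    Finset.univ.filter fun π => ∀ w ∈ insert v T, w ≠ s → π.symm w < π.symm s with hN
  have hNv : (Finset.univ.filter fun π : Fin n ≃ V => ∀ w ∈ T, π.symm w < π.symm v) = N v := by
    ext π
    simp only [hN, Finset.mem_filter, Finset.mem_univ, true_and, Finset.mem_insert]
    constructor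
    · rintro h w (rfl | hw) hne
      · exact absurd rfl hne
      · exact h w hw
    · intro h w hw
      exact h w (Or.inr hw) fun hh => hv (hh ▸ hw)
  have hcard : ∀ s ∈ insert v T, (N s).card = (N v).card := by
    intro s hs
    have hmaps : ∀ w ∈ insert v T, Equiv.swap s v w ∈ insert v T := by
      intro w hw
      rcases eq_or_ne w s with rfl | h1
      · simp
      rcases eq_or_ne w v with rfl | h2
      · simpa using Finset.mem_insert.1 hs
      · rwa [Equiv.swap_apply_of_ne_of_ne h1 h2]
    have key : ∀ a b : V, (a = s ∧ b = v ∨ a = v ∧ b = s) → ∀ π ∈ N a,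
        π.trans (Equiv.swap s v) ∈ N b := by
      intro a b hab π hπ
      simp only [hN, Finset.mem_filter, Finset.mem_univ, true_and] at hπ ⊢
      intro w hw hwb
      simp only [Equiv.symm_trans_apply, Equiv.symm_swap]
      have hb : Equiv.swap s v b = a := by
        rcases hab with ⟨rfl, rfl⟩ | ⟨rfl, rfl⟩ <;> simp
      rw [hb]
      refine hπ _ (hmaps w hw) fun h => hwb ?_
      exact (Equiv.swap s v).injective (h.trans hb.symm)
    have hinv : ∀ π : Fin n ≃ V, (π.trans (Equiv.swap s v)).trans (Equiv.swap s v) = π := by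
      intro π; ext i; simp
    exact Finset.card_nbij' (fun π => π.trans (Equiv.swap s v)) (fun π => π.trans (Equiv.swap s v))
      (key s v (Or.inl ⟨rfl, rfl⟩)) (key v s (Or.inr ⟨rfl, rfl⟩))
      (fun π _ => hinv π) (fun π _ => hinv π)
  have hunion : (insert v T).biUnion N = Finset.univ := by
    refine Finset.eq_univ_of_forall fun π => ?_
    obtain ⟨s, hs, hmax⟩ := Finset.exists_max_image (insert v T) π.symm ⟨v, Finset.mem_insert_self v T⟩
    refine Finset.mem_biUnion.2 ⟨s, hs, ?_⟩
    simp only [hN, Finset.mem_filter, Finset.mem_univ, true_and]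
    exact fun w hw hne => lt_of_le_of_ne (hmax w hw) fun h => hne (π.symm.injective h)
  have hdisj : Set.PairwiseDisjoint (↑(insert v T)) N := by
    intro s hs t ht hst
    refine Finset.disjoint_left.2 fun π h1 h2 => ?_
    simp only [hN, Finset.mem_filter, Finset.mem_univ, true_and] at h1 h2
    exact lt_asymm (h1 t ht hst.symm) (h2 s hs hst)
  have := Finset.card_biUnion hdisj
  rw [hunion, Finset.sum_congr rfl hcard, Finset.sum_const, Finset.card_insert_of_notMem hv,
    Finset.card_univ] at this
  rw [hNv, this, smul_eq_mul, mul_comm]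

theorem integral_prod_one_sub (q : V → ℝ) (v : V) :
    ∫ t in (0 : ℝ)..1, ∏ w ∈ Finset.univ.erase v, (1 - t * q w) =
      ∑ T ∈ (Finset.univ.erase v).powerset, (∏ w ∈ T, -q w) * (1 / (T.card + 1)) := by
  have h : ∀ t : ℝ, ∏ w ∈ Finset.univ.erase v, (1 - t * q w) =
      ∑ T ∈ (Finset.univ.erase v).powerset, (∏ w ∈ T, -q w) * t ^ T.card := by
    intro t
    simp only [sub_eq_add_neg]
    rw [Finset.prod_one_add]
    refine Finset.sum_congr rfl fun T _ => ?_
    rw [mul_comm, ← Finset.prod_const, ← Finset.prod_mul_distrib]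
    exact Finset.prod_congr rfl fun w _ => by ring
  simp only [h]
  rw [intervalIntegral.integral_finsetSum
    fun T _ => Continuous.intervalIntegrable (by fun_prop) _ _]
  refine Finset.sum_congr rfl fun T _ => ?_
  rw [intervalIntegral.integral_const_mul, integral_pow]
  simp

/-- Both sides are expanded over sets `T` of other vertices. The chance that all of `T` precedes `v`
is `1 / (T.card + 1) = ∫ t ^ T.card`, as if `v` arrived at a uniform time `t` and every other vertex
preceded it independently with probability `t`. -/
theorem average_firstProb (q : V → ℝ) (v : V) :
    ∑ π : Fin (Fintype.card V) ≃ V, firstProb q v (List.ofFn fun i => π i) =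
      Fintype.card (Fin (Fintype.card V) ≃ V) *
        (q v * ∫ t in (0 : ℝ)..1, ∏ w ∈ Finset.univ.erase v, (1 - t * q w)) := by
  have h1 : ∀ π : Fin (Fintype.card V) ≃ V, firstProb q v (List.ofFn fun i => π i) =
      q v * ∑ T ∈ (Finset.univ.erase v).powerset,
        if ∀ w ∈ T, π.symm w < π.symm v then ∏ w ∈ T, -q w else 0 := by
    intro π
    have hnd : (List.ofFn fun i => π i).Nodup := List.nodup_ofFn.2 π.injective
    have hidx : ∀ w, (List.ofFn fun i => π i).idxOf w = (π.symm w : ℕ) := by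
      intro w
      have := hnd.idxOf_getElem (π.symm w) (by simp)
      simpa using this
    rw [firstProb_eq_prod q hnd (by simpa [List.mem_ofFn] using π.surjective v)]
    simp only [hidx, Fin.val_fin_lt]
    rw [← Finset.mul_prod_erase Finset.univ _ (Finset.mem_univ v), if_neg (lt_irrefl _),
      add_zero, one_mul, Finset.prod_one_add]
    refine congrArg _ (Finset.sum_congr rfl fun T _ => ?_)
    rw [Finset.prod_ite_zero]
    split_ifs <;> rfl
  simp only [h1]
  rw [← Finset.mul_sum, Finset.sum_comm, integral_prod_one_sub, mul_left_comm]
  congr 1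
  rw [Finset.mul_sum]
  refine Finset.sum_congr rfl fun T hT => ?_
  have hv : v ∉ T := fun h => Finset.notMem_erase v _ (Finset.mem_powerset.1 hT h)
  rw [← Finset.sum_filter, Finset.sum_const, nsmul_eq_mul, ← card_before_mul T hv]
  push_cast
  have : (T.card : ℝ) + 1 ≠ 0 := by positivity
  field_simp

theorem probMem_uniformOrder_bind {W : Type*} (q : V → ℝ) (f : List V → PMF (Finset (V × W)))
    (e : V × W) (hf : ∀ vs : List V, vs.Nodup → probMem (f vs) e = firstProb q e.1 vs) :
    probMem ((uniformOrder V).bind f) e =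
      q e.1 * ∫ t in (0 : ℝ)..1, ∏ w ∈ Finset.univ.erase e.1, (1 - t * q w) := by
  rw [uniformOrder, PMF.bind_map, probMem_bind]
  have h : ∀ π : Fin (Fintype.card V) ≃ V,
      probMem ((f ∘ fun π : Fin (Fintype.card V) ≃ V => List.ofFn fun i => π i) π) e =
        firstProb q e.1 (List.ofFn fun i => π i) :=
    fun π => hf _ (List.nodup_ofFn.2 π.injective)
  simp only [h, PMF.uniformOfFintype_apply]
  rw [← Finset.mul_sum, average_firstProb, ← mul_assoc, ENNReal.toReal_inv, ENNReal.toReal_natCast,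
    inv_mul_cancel₀, one_mul]
  have : Nonempty (Fin (Fintype.card V) ≃ V) := ⟨(Fintype.equivFin V).symm⟩
  exact_mod_cast Fintype.card_ne_zero

end Average

/-! ### The matching probability of an edge as an integral -/

section Matching

variable {V W : Type*} [DecidableEq V] [DecidableEq W] [Fintype V] [Fintype W]

theorem probMem_randomMatching {E : Finset (V × W)} {p : V × W → unitInterval}
    {x xt : V × W → ℝ} {D : V → PMF (List (V × W))} (hD : ∀ v, IsProportional E p x v (D v))
    (hxt : ∀ e ∈ E, 0 ≤ xt e ∧ xt e ≤ x e) (e : V × W) :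
    probMem (randomMatching E p fun v => proposalDist p x xt (D v)) e =
      (if e ∈ E then xt e else 0) * ∫ t in (0 : ℝ)..1, ∏ w ∈ Finset.univ.erase e.1,
        (1 - t * if (w, e.2) ∈ E then xt (w, e.2) else 0) := by
  set S : V → PMF (Option (V × W)) := fun v => (proposalDist p x xt (D v)).bind (coinFirst p)
    with hSdef
  have hr : ∀ e ∈ E, 0 ≤ xt e / x e ∧ xt e / x e ≤ 1 := fun f hf =>
    have h0 := (hxt f hf).1.trans (hxt f hf).2
    ⟨div_nonneg (hxt f hf).1 h0, div_le_one_of_le₀ (hxt f hf).2 h0⟩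
  have hSval : ∀ v f, S v (some f) = if f ∈ edgesL E v then
      ENNReal.ofReal (xt f / x f) * ENNReal.ofReal (x f) else 0 := fun v f =>
    proposalDist_bind_coinFirst (hD v) (fun f hf => hr f (Finset.mem_filter.1 hf).1) f
  have hSq : ∀ w u, (S w (some (w, u))).toReal = if (w, u) ∈ E then xt (w, u) else 0 := by
    intro w u
    rw [hSval]
    by_cases h : (w, u) ∈ E
    · obtain ⟨h0, h1⟩ := hxt _ h
      rw [if_pos (show (w, u) ∈ edgesL E w from Finset.mem_filter.2 ⟨h, rfl⟩), if_pos h, ← ENNReal.ofReal_mul (hr _ h).1,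
        ENNReal.toReal_ofReal (mul_nonneg (hr _ h).1 (h0.trans h1))]
      -- If `x e = 0`, then `0 ≤ xt e ≤ x e` forces `xt e = 0`, so the convention for division by
      -- zero is harmless.
      exact div_mul_cancel_of_imp fun hx => le_antisymm (hx ▸ h1) h0
    · rw [if_neg fun hh : (w, u) ∈ edgesL E w => h (Finset.mem_filter.1 hh).1, if_neg h, ENNReal.toReal_zero]
  have hS0 : ∀ v f, f.1 ≠ v → S v (some f) = 0 := fun v f hf => by
    rw [hSval, if_neg fun hh : f ∈ edgesL E v => hf (Finset.mem_filter.1 hh).2]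
  rw [randomMatching, PMF.bind_comm,
    probMem_uniformOrder_bind (fun w => (S w (some (w, e.2))).toReal) _ e]
  · simp only [hSq]
  · intro vs hvs
    rw [realized_bind_process p _ (fun v l hl => proposalDist_support (hD v) hl) vs hvs]
    exact probMem_proposalProcess S hS0 e vs fun f hf => absurd hf (Finset.notMem_empty f)

end Matching

/-! ### Dummy edges -/

section Dummy

variable {A B : Type*} [DecidableEq A] [DecidableEq B] [Fintype B]

theorem inl_mem_dummyE (E : Finset (A × B)) (a : A) (u : B) :
    (Sum.inl a, u) ∈ dummyE E ↔ (a, u) ∈ E := by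
  simp [dummyE]

theorem inr_mem_dummyE (E : Finset (A × B)) (b u : B) :
    (Sum.inr b, u) ∈ dummyE E ↔ b = u := by
  simp [dummyE]

omit [Fintype B] in
theorem sum_edgesR [Fintype A] (E : Finset (A × B)) (x : A × B → ℝ) (u : B) :
    ∑ e ∈ edgesR E u, x e = ∑ a, if (a, u) ∈ E then x (a, u) else 0 := by
  rw [← Finset.sum_filter]
  refine Finset.sum_bij' (fun e _ => e.1) (fun a _ => (a, u)) ?_ ?_ ?_ ?_ ?_
  · rintro ⟨a, b⟩ h
    obtain ⟨h1, rfl⟩ := Finset.mem_filter.1 h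
    simpa using h1
  · intro a h
    simpa [edgesR] using h
  · rintro ⟨a, b⟩ h
    obtain ⟨h1, rfl⟩ := Finset.mem_filter.1 h
    rfl
  · intro a _; rfl
  · rintro ⟨a, b⟩ h
    obtain ⟨h1, rfl⟩ := Finset.mem_filter.1 h
    rfl

/-- The purpose of the dummy edges: the total at every right vertex is `σ` exactly, as
`g_mul_integral_prod_bounds` needs. -/
theorem sum_dummyX [Fintype A] (E : Finset (A × B)) (x : A × B → ℝ) (σ : ℝ) (u : B) :
    ∑ w, (if (w, u) ∈ dummyE E then dummyX E x σ (w, u) else 0) = σ := by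
  rw [Fintype.sum_sum_type]
  simp only [inl_mem_dummyE, inr_mem_dummyE, dummyX]
  rw [← sum_edgesR]
  simp

theorem dummyX_nonneg {E : Finset (A × B)} {x : A × B → ℝ} {σ : ℝ} (hx : ∀ e ∈ E, 0 ≤ x e)
    (hσ : ∀ u : B, ∑ e ∈ edgesR E u, x e ≤ σ) (e : (A ⊕ B) × B) (he : e ∈ dummyE E) :
    0 ≤ dummyX E x σ e := by
  obtain ⟨a | b, u⟩ := e
  · exact hx _ ((inl_mem_dummyE E a u).1 he)
  · exact sub_nonneg.2 (hσ u)

end Dummy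

end QueryCommit

theorem lemma3 {A B : Type*} [Fintype A] [Fintype B] [DecidableEq A] [DecidableEq B]
    (E : Finset (A × B)) (p : A × B → unitInterval) (x : A × B → ℝ) (σ : ℝ)
    (hx : QueryCommit.IsLPSolution E p x)
    (hσ0 : 0 < σ) (hσ1 : σ ≤ 1)
    (hσ : ∀ u : B, ∑ e ∈ QueryCommit.edgesR E u, x e ≤ σ)
    (D : A ⊕ B → PMF (List ((A ⊕ B) × B)))
    (hD : ∀ v : A ⊕ B, QueryCommit.IsProportional (QueryCommit.dummyE E) (QueryCommit.dummyP p)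
      (QueryCommit.dummyX E x σ) v (D v)) :
    ∀ e ∈ QueryCommit.dummyE E,
      (1 - Real.exp (-σ)) * QueryCommit.dummyX E x σ e / σ
          ≤ QueryCommit.probMem (QueryCommit.alg1 E p x σ D) e ∧
        QueryCommit.probMem (QueryCommit.alg1 E p x σ D) e
          ≤ QueryCommit.dummyX E x σ e * (1 + Real.exp (-σ)) / 2 := by

  intro e he
  have h0 := QueryCommit.dummyX_nonneg hx.nonneg hσ
  -- Non-edges get value `0`; since `g 0 σ = 0`, they contribute a factor `1`, and the product may
  -- run over all left vertices.
  set y : A ⊕ B → ℝ := fun w =>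
    if (w, e.2) ∈ QueryCommit.dummyE E then QueryCommit.dummyX E x σ (w, e.2) else 0 with hy
  have hy0 : ∀ w, 0 ≤ y w := by
    intro w
    simp only [hy]
    split_ifs with h
    · exact h0 _ h
    · exact le_rfl
  have hsum : ∀ u : B, ∑ w, (if (w, u) ∈ QueryCommit.dummyE E then
      QueryCommit.dummyX E x σ (w, u) else 0) = σ := QueryCommit.sum_dummyX E x σ
  have hle : ∀ f ∈ QueryCommit.dummyE E, QueryCommit.dummyX E x σ f ≤ σ := by
    rintro ⟨w, u⟩ hf
    rw [← hsum u]
    have := Finset.single_le_sum (f := fun w => if (w, u) ∈ QueryCommit.dummyE E then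
      QueryCommit.dummyX E x σ (w, u) else 0) (fun w _ => ?_) (Finset.mem_univ w)
    · simpa only [if_pos hf, hsum u] using this
    · split_ifs with h
      · exact h0 _ h
      · exact le_rfl
  have hg : ∀ w, (if (w, e.2) ∈ QueryCommit.dummyE E then
      QueryCommit.g (QueryCommit.dummyX E x σ (w, e.2)) σ else 0) = QueryCommit.g (y w) σ := by
    intro w
    simp only [hy]
    split_ifs
    · rfl
    · exact (QueryCommit.g_zero hσ0).symm
  have hye : y e.1 = QueryCommit.dummyX E x σ e := if_pos he
  rw [QueryCommit.alg1, QueryCommit.probMem_randomMatching hD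
    (fun f hf => ⟨QueryCommit.g_nonneg hσ0 (h0 f hf) (hle f hf),
      QueryCommit.g_le_self hσ0 (h0 f hf) (hle f hf)⟩) e]
  simp only [hg]
  rw [← hye]
  exact QueryCommit.g_mul_integral_prod_bounds hσ0 hσ1 y hy0 (hsum e.2) e.1
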